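/- Theorem 1 (Outer bound). Let $(P_{Y_jZ_j|X})_{j=1}^{N}$ be a finite family of discrete memoryless two-user broadcast channels with finite input alphabet $\mathcal X$ and finite output alphabets $\mathcal Y,\mathcal Z$. A rate triple $(R_0,R_1,R_2)$ is achievable if there is a sequence of block-length-$n$ codes with $M_{0n}$ common and $M_{1n},M_{2n}$ private messages (all positive numbers), whose encoder does not know the channel index $j$, such that $\liminf_n \frac1n\log_2 M_{kn}\ge R_k$ for $k=0,1,2$ and $\max_j P_e^{(n)}(j)\to 0$; here $P_e^{(n)}(j)$ is the probability, for independent uniformly distributed messages sent over channel $j$, that user 1 fails to recover $(W_0,W_1)$ or user 2 fails to recover $(W_0,W_2)$. The capacity region $\mathcal C_{\mathcal J}$ is the set of all achievable triples. For a joint pmf $p_{QUVX}$, with $(Q,U,V)\to X\to(Y_j,Z_j)$ a Markov chain, let $\mathcal R^{(j)}_{\mathrm{NEG}}(p_{QUVX})$ be the set of pairs $(R_1,R_2)$ with $$R_1\le I(QU;Y_j),\qquad R_2\le I(QV;Z_j),$$ $$R_1+R_2\le I(U;Y_j|QV)+I(QV;Z_j),\qquad R_1+R_2\le I(QU;Y_j)+I(V;Z_j|QU),$$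 all information measures being in bits. Then, for every $(R_0,R_1,R_2)\in\mathcal C_{\mathcal J}$ (in particular for private messages only, i.e. $R_0=0$), $$(R_1,R_2)\in\bigcup_{P_UP_V}\ \bigcap_{j=1}^{N}\ \bigcup_{P_{QX|UV}}\mathcal R^{(j)}_{\mathrm{NEG}}(p_{QUVX}),\qquad p_{QUVX}=P_U\,P_V\,P_{QX|UV}.$$ Here $Q,U,V$ range over random variables with finite alphabets; $U$ and $V$ are independent and their laws $P_U,P_V$ do not depend on $j$, whereas the conditional law $P_{QX|UV}$ may depend on $j$ and is such that $X$ is a deterministic function of $(Q,U,V)$. -/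

import Mathlib

open Filter Topology

noncomputable section

namespace CompoundBC

/-! ### Information measures of finite random variables, in bits

A finite probability space is a finite type `Ω` with a pmf `p : Ω → ℝ`; a random variable is
a map on `Ω`. -/

section Information

variable {Ω A B C : Type*} [Fintype Ω]
  [Fintype A] [DecidableEq A] [Fintype B] [DecidableEq B] [Fintype C] [DecidableEq C]

/-- The pmf of the random variable `a` under `p`. -/
def law (p : Ω → ℝ) (a : Ω → A) (s : A) : ℝ := ∑ ω with a ω = s, p ω

/-- Shannon entropy `H(a)` in bits. -/
def entropy (p : Ω → ℝ) (a : Ω → A) : ℝ := ∑ s, Real.negMulLog (law p a s) / Real.log 2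

/-- Conditional entropy `H(a | c) = H(a, c) - H(c)`. -/
def condEntropy (p : Ω → ℝ) (a : Ω → A) (c : Ω → C) : ℝ :=
  entropy p (fun ω => (a ω, c ω)) - entropy p c

/-- Mutual information `I(a ; b) = H(a) - H(a | b)`. -/
def mutualInfo (p : Ω → ℝ) (a : Ω → A) (b : Ω → B) : ℝ :=
  entropy p a - condEntropy p a b

/-- Conditional mutual information `I(a ; b | c) = H(a | c) - H(a | b, c)`. -/
def condMutualInfo (p : Ω → ℝ) (a : Ω → A) (b : Ω → B) (c : Ω → C) : ℝ :=
  condEntropy p a c - condEntropy p a (fun ω => (b ω, c ω))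

end Information

/-! ### Codes, achievable rates and the capacity region -/

section Capacity

variable {X Y Z : Type*} {N : ℕ}

/-- A code of block length `n` with message sets of sizes `M₀` (common), `M₁`, `M₂` (private).
The encoder does not know the channel index `j`; the decoders of the pair of users with index `j`
may use `j`. A decoder returns `none` to declare an error. -/
structure Code (X Y Z : Type*) (N M₀ M₁ M₂ n : ℕ) where
  /-- The codeword of a message triple. -/
  enc : Fin M₀ → Fin M₁ → Fin M₂ → Fin n → X
  /-- The decoder of the first user of each pair. -/
  dec₁ : Fin N → (Fin n → Y) → Option (Fin M₀ × Fin M₁)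
  /-- The decoder of the second user of each pair. -/
  dec₂ : Fin N → (Fin n → Z) → Option (Fin M₀ × Fin M₂)

/-- The probability that, over the memoryless extension of the `j`-th broadcast channel and for
independent uniform messages, at least one of the two users fails to recover its message pair. -/
def Code.errorProb [Fintype Y] [Fintype Z] {M₀ M₁ M₂ n : ℕ}
    (W : Fin N → X → Y × Z → ℝ) (c : Code X Y Z N M₀ M₁ M₂ n) (j : Fin N) : ℝ :=
  (∑ w₀ : Fin M₀, ∑ w₁ : Fin M₁, ∑ w₂ : Fin M₂, ∑ y : Fin n → Y, ∑ z : Fin n → Z,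
    if c.dec₁ j y ≠ some (w₀, w₁) ∨ c.dec₂ j z ≠ some (w₀, w₂)
      then ∏ i, W j (c.enc w₀ w₁ w₂ i) (y i, z i) else 0) / ((M₀ : ℝ) * M₁ * M₂)

/-- `(R₀, R₁, R₂)` is achievable: there is a sequence of codes with nonempty message sets, of
asymptotic rates at least `R₀, R₁, R₂`, whose error probability tends to `0` in the worst case
over the channel index. -/
def Achievable [Fintype Y] [Fintype Z] (W : Fin N → X → Y × Z → ℝ) (R₀ R₁ R₂ : ℝ) : Prop :=
  ∃ (M₀ M₁ M₂ : ℕ → ℕ) (c : ∀ n, Code X Y Z N (M₀ n) (M₁ n) (M₂ n) n),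
    (∀ n, 0 < M₀ n ∧ 0 < M₁ n ∧ 0 < M₂ n) ∧
    (R₀ : EReal) ≤ liminf (fun n : ℕ => ((1 / (n : ℝ) * Real.logb 2 (M₀ n) : ℝ) : EReal)) atTop ∧
    (R₁ : EReal) ≤ liminf (fun n : ℕ => ((1 / (n : ℝ) * Real.logb 2 (M₁ n) : ℝ) : EReal)) atTop ∧
    (R₂ : EReal) ≤ liminf (fun n : ℕ => ((1 / (n : ℝ) * Real.logb 2 (M₂ n) : ℝ) : EReal)) atTop ∧
    Tendsto (fun n => ⨆ j : Fin N, (c n).errorProb W j) atTop (𝓝 0)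

/-- The capacity region: the set of all achievable rate triples `(R₀, R₁, R₂)`. -/
def capacityRegion [Fintype Y] [Fintype Z] (W : Fin N → X → Y × Z → ℝ) : Set (ℝ × ℝ × ℝ) :=
  {R | Achievable W R.1 R.2.1 R.2.2}

end Capacity

/-! ### The Nair–El Gamal region -/

section NairElGamal

variable {Q U V X Y Z : Type*}

/-- The pmf of `(Q, U, V, X)` with `U`, `V` independent and `(Q, X)` drawn from `pQX u v`. -/
def inputLaw (pU : U → ℝ) (pV : V → ℝ) (pQX : U → V → Q × X → ℝ) : Q × U × V × X → ℝ :=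
  fun (q, u, v, x) => pU u * pV v * pQX u v (q, x)

/-- Under the conditional pmf `pQX` of `(Q, X)` given `(U, V)`, the channel input `X` is a
deterministic function of `(Q, U, V)`. -/
def InputDeterministic (pQX : U → V → Q × X → ℝ) : Prop :=
  ∃ f : Q × U × V → X, ∀ u v q x, pQX u v (q, x) ≠ 0 → x = f (q, u, v)

/-- The pmf of `(Q, U, V, X, Y, Z)` when `(Q, U, V, X)` has pmf `p` and `(Y, Z)` is the output of
the broadcast channel `W` with input `X`. -/
def jointLaw (p : Q × U × V × X → ℝ) (W : X → Y × Z → ℝ) : Q × U × V × X × Y × Z → ℝ :=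
  fun (q, u, v, x, y, z) => p (q, u, v, x) * W x (y, z)

variable [Fintype Q] [DecidableEq Q] [Fintype U] [DecidableEq U] [Fintype V] [DecidableEq V]
  [Fintype X] [Fintype Y] [DecidableEq Y] [Fintype Z] [DecidableEq Z]

/-- The Nair–El Gamal region (private messages) of the broadcast channel `W`, for the pmf `p` of
`(Q, U, V, X)`: the pairs `(R₁, R₂)` with
`R₁ ≤ I(QU;Y)`, `R₂ ≤ I(QV;Z)`, `R₁ + R₂ ≤ I(U;Y|QV) + I(QV;Z)` and
`R₁ + R₂ ≤ I(QU;Y) + I(V;Z|QU)`. -/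
def negRegion (W : X → Y × Z → ℝ) (p : Q × U × V × X → ℝ) : Set (ℝ × ℝ) :=
  let P := jointLaw p W
  let rvU : Q × U × V × X × Y × Z → U := fun (_, u, _, _, _, _) => u
  let rvV : Q × U × V × X × Y × Z → V := fun (_, _, v, _, _, _) => v
  let rvQU : Q × U × V × X × Y × Z → Q × U := fun (q, u, _, _, _, _) => (q, u)
  let rvQV : Q × U × V × X × Y × Z → Q × V := fun (q, _, v, _, _, _) => (q, v)
  let rvY : Q × U × V × X × Y × Z → Y := fun (_, _, _, _, y, _) => y
  let rvZ : Q × U × V × X × Y × Z → Z := fun (_, _, _, _, _, z) => z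
  {R | R.1 ≤ mutualInfo P rvQU rvY ∧
       R.2 ≤ mutualInfo P rvQV rvZ ∧
       R.1 + R.2 ≤ condMutualInfo P rvU rvY rvQV + mutualInfo P rvQV rvZ ∧
       R.1 + R.2 ≤ mutualInfo P rvQU rvY + condMutualInfo P rvV rvZ rvQU}

end NairElGamal

end CompoundBC

end

/-! The constraints of one channel see $(Q,U,V)$ only through a little data. Since $X$ is a function
of $(Q,U,V)$, $H(Y|QUV)=H(Y|X)$ depends only on the law $p$ of $X$, and likewise for $Z$. What
remains is $H(Y)$, $H(Z)$, also functions of $p$, and the output entropies conditioned on $(Q,U)$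
and on $(Q,V)$. Each of these two conditionings gives, together with $p$, a point of the convex hull
of the graph $p\mapsto(p,H(Y),H(Z))$. The bound is thus a statement about two points of
`entropyHull` over the same $p$ (`hullPairs`, `rateExcess`).

Converse, for each channel separately: Fano's inequality and independence of the messages bound the
rates by block entropies. Conditioning on a message, the past of $Y$ and the future of $Z$ turns
these into sums of single-letter terms, by a Csiszár-type telescoping identity
(`entropy_sub_entropy_eq_sum`). Averaging over time stays in the convex hull
(`exists_mem_entropyHull_of_message`). Compactness of the hull removes the error terms in the limit
(`Achievable.exists_hullPairs`).

Realisation with laws of $U,V$ common to all channels: the two hull points are mixtures of input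
pmfs, indexed by $S$ and $T$, both with mean $p$. Take $S$ and $T$ conditionally independent given
$X$, and let $Q$ be a one-time-pad encryption of $(S,T,X)$, with independent uniform keys
$U=(k_1,k_2)$ and $V=(l_1,l_2)$. Then $(Q,U)$ reveals about $X$ exactly $S$, $(Q,V)$ reveals exactly
$T$, and $(Q,U,V)$ reveals $X$ (`mem_negRegion_padKernel`). All dependence on the channel sits in
the kernel of $(Q,X)$. Carathéodory's theorem bounds the number of mixture components in terms of
$|\mathcal X|$ alone, so one key group serves every channel. -/

noncomputable section

namespace CompoundBC

set_option linter.unusedSectionVars false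

/-! ### Entropy of finite random variables: Gibbs, submodularity, chain rule, Fano -/

section Information

variable {Ω A B C D : Type*} [Fintype Ω]
  [Fintype A] [DecidableEq A] [Fintype B] [DecidableEq B] [Fintype C] [DecidableEq C]
  [Fintype D] [DecidableEq D]

/-- The entropy in bits of a pmf on a finite type. -/
def shannon {A : Type*} [Fintype A] (f : A → ℝ) : ℝ := ∑ s, Real.negMulLog (f s) / Real.log 2

theorem log_two_pos : 0 < Real.log 2 := Real.log_pos one_lt_two

theorem entropy_eq_shannon (p : Ω → ℝ) (a : Ω → A) : entropy p a = shannon (law p a) := rfl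

theorem law_nonneg {p : Ω → ℝ} (hp : ∀ ω, 0 ≤ p ω) (a : Ω → A) (s : A) : 0 ≤ law p a s :=
  Finset.sum_nonneg fun ω _ => hp ω

theorem sum_law_mul (p : Ω → ℝ) (a : Ω → A) (g : A → ℝ) :
    ∑ s, law p a s * g s = ∑ ω, p ω * g (a ω) := by
  simp only [law, Finset.sum_mul]
  rw [← Finset.sum_fiberwise Finset.univ a fun ω => p ω * g (a ω)]
  refine Finset.sum_congr rfl fun s _ => Finset.sum_congr rfl fun ω hω => ?_
  rw [(Finset.mem_filter.1 hω).2]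

theorem sum_law (p : Ω → ℝ) (a : Ω → A) : ∑ s, law p a s = ∑ ω, p ω := by
  simpa using sum_law_mul p a fun _ => 1

theorem law_eq_sum_ite (p : Ω → ℝ) (a : Ω → A) (s : A) :
    law p a s = ∑ ω, if a ω = s then p ω else 0 := by
  rw [law, Finset.sum_filter]

theorem law_mem_stdSimplex {p : Ω → ℝ} (hp : p ∈ stdSimplex ℝ Ω) (a : Ω → A) :
    law p a ∈ stdSimplex ℝ A :=
  ⟨law_nonneg hp.1 a, (sum_law p a).trans hp.2⟩

theorem sum_law_pair_right (p : Ω → ℝ) (a : Ω → A) (b : Ω → B) (s : A) :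
    ∑ t, law p (fun ω => (a ω, b ω)) (s, t) = law p a s := by
  simp only [law_eq_sum_ite, Prod.mk.injEq]
  rw [Finset.sum_comm]
  refine Finset.sum_congr rfl fun ω _ => ?_
  by_cases h : a ω = s <;> simp [h]

theorem sum_law_pair_left (p : Ω → ℝ) (a : Ω → A) (b : Ω → B) (t : B) :
    ∑ s, law p (fun ω => (a ω, b ω)) (s, t) = law p b t := by
  simp only [law_eq_sum_ite, Prod.mk.injEq]
  rw [Finset.sum_comm]
  refine Finset.sum_congr rfl fun ω _ => ?_
  by_cases h : b ω = t <;> simp [h]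

theorem law_unit_pair (p : Ω → ℝ) (b : Ω → B) (t : B) :
    law p (fun ω => ((), b ω)) ((), t) = law p b t := by
  simp [law_eq_sum_ite]

theorem entropy_eq_sum (p : Ω → ℝ) (a : Ω → A) :
    entropy p a = ∑ ω, p ω * (-Real.log (law p a (a ω)) / Real.log 2) := by
  rw [← sum_law_mul p a fun s => -Real.log (law p a s) / Real.log 2]
  refine Finset.sum_congr rfl fun s _ => ?_
  rw [Real.negMulLog]; ring

/-- Entropy depends only on the partition of the sample space into the fibres. -/
theorem entropy_congr (p : Ω → ℝ) {a : Ω → A} {b : Ω → B}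
    (h : ∀ ω ω', a ω = a ω' ↔ b ω = b ω') : entropy p a = entropy p b := by
  rw [entropy_eq_sum, entropy_eq_sum]
  refine Finset.sum_congr rfl fun ω _ => ?_
  have : law p a (a ω) = law p b (b ω) := by simp only [law, h]
  rw [this]

/-- This is $\log t\le t-1$ at $t=y/x$. The correction `y - x` sums to something nonpositive as soon
as the comparison function has no more total mass than the pmf, so subprobabilities are allowed in
Gibbs' inequality. -/
theorem negMulLog_le_of_nonneg {x y : ℝ} (hx : 0 ≤ x) (hy : 0 ≤ y) (h : y = 0 → x = 0) :
    Real.negMulLog x ≤ x * -Real.log y + (y - x) := by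
  rcases hx.eq_or_lt with rfl | hx
  · simpa using hy
  have hy : 0 < y := hy.lt_of_ne fun h0 => hx.ne' (h h0.symm)
  have h1 := Real.log_le_sub_one_of_pos (div_pos hy hx)
  rw [Real.log_div hy.ne' hx.ne'] at h1
  have h2 : x * (Real.log y - Real.log x) ≤ x * (y / x - 1) := mul_le_mul_of_nonneg_left h1 hx.le
  have h3 : x * (y / x - 1) = y - x := by field_simp
  rw [Real.negMulLog]
  linarith

/-- Gibbs' inequality. -/
theorem shannon_le_of_sum_le {p q : A → ℝ} (hp : ∀ s, 0 ≤ p s) (hq : ∀ s, 0 ≤ q s)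
    (h : ∀ s, q s = 0 → p s = 0) (hs : ∑ s, q s ≤ ∑ s, p s) :
    shannon p ≤ ∑ s, p s * (-Real.log (q s) / Real.log 2) := by
  have h1 : ∑ s, Real.negMulLog (p s) ≤ ∑ s, p s * -Real.log (q s) := by
    calc ∑ s, Real.negMulLog (p s) ≤ ∑ s, (p s * -Real.log (q s) + (q s - p s)) :=
          Finset.sum_le_sum fun s _ => negMulLog_le_of_nonneg (hp s) (hq s) (h s)
      _ = ∑ s, p s * -Real.log (q s) + (∑ s, q s - ∑ s, p s) := by
          rw [Finset.sum_add_distrib, Finset.sum_sub_distrib]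
      _ ≤ _ := by linarith
  rw [shannon, ← Finset.sum_div]
  simp only [← mul_div_assoc]
  rw [← Finset.sum_div]
  exact div_le_div_of_nonneg_right h1 log_two_pos.le

theorem law_eq_zero_of_comp {p : Ω → ℝ} (hp : ∀ ω, 0 ≤ p ω) {a : Ω → A} (f : A → B) {s : A}
    (h : law p (fun ω => f (a ω)) (f s) = 0) : law p a s = 0 := by
  refine Finset.sum_eq_zero fun ω hω => ?_
  exact (Finset.sum_eq_zero_iff_of_nonneg fun ω _ => hp ω).1 h ω (by
    simp only [Finset.mem_filter, Finset.mem_univ, true_and] at hω ⊢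
    rw [hω])

/-- Submodularity of entropy. -/
theorem entropy_submodular {p : Ω → ℝ} (hp : ∀ ω, 0 ≤ p ω) (a : Ω → A) (b : Ω → B) (c : Ω → C) :
    entropy p (fun ω => (a ω, b ω, c ω)) + entropy p c
      ≤ entropy p (fun ω => (a ω, c ω)) + entropy p (fun ω => (b ω, c ω)) := by
  set r := law p (fun ω => (a ω, b ω, c ω)) with hr
  set f := law p (fun ω => (a ω, c ω)) with hf
  set g := law p (fun ω => (b ω, c ω)) with hg
  set h := law p c with hh
  have f0 : ∀ s, 0 ≤ f s := law_nonneg hp _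
  have g0 : ∀ s, 0 ≤ g s := law_nonneg hp _
  have h0 : ∀ s, 0 ≤ h s := law_nonneg hp _
  have rf : ∀ s, f (s.1, s.2.2) = 0 → r s = 0 := fun s hs =>
    law_eq_zero_of_comp hp (a := fun ω => (a ω, b ω, c ω)) (fun t => (t.1, t.2.2)) hs
  have rg : ∀ s, g (s.2.1, s.2.2) = 0 → r s = 0 := fun s hs =>
    law_eq_zero_of_comp hp (a := fun ω => (a ω, b ω, c ω)) (fun t => (t.2.1, t.2.2)) hs
  have rh : ∀ s, h s.2.2 = 0 → r s = 0 := fun s hs =>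
    law_eq_zero_of_comp hp (a := fun ω => (a ω, b ω, c ω)) (fun t => t.2.2) hs
  -- The comparison law makes `a` and `b` conditionally independent given `c`, keeping the marginals
  -- of `(a, c)` and `(b, c)`. Where `h` vanishes the quotient is 0, and so is `r`.
  let q : A × B × C → ℝ := fun s => f (s.1, s.2.2) * g (s.2.1, s.2.2) / h s.2.2
  have hq : ∑ s, q s ≤ ∑ s, r s := by
    have e1 : ∑ s, r s = ∑ k, h k := by rw [hr, hh, sum_law, sum_law]
    rw [e1]
    calc ∑ s, q s = ∑ k, (∑ x, f (x, k)) * (∑ y, g (y, k)) / h k := by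
          simp only [q, Fintype.sum_prod_type, Finset.sum_mul_sum, Finset.sum_div]
          rw [Finset.sum_comm' (t' := Finset.univ) (s' := fun _ => Finset.univ) (by simp)]
          rw [Finset.sum_congr rfl fun y _ => Finset.sum_comm]
          rw [Finset.sum_comm]
          exact Finset.sum_congr rfl fun k _ => Finset.sum_comm
      _ = ∑ k, h k := by
          refine Finset.sum_congr rfl fun k _ => ?_
          rw [hf, hg, sum_law_pair_left, sum_law_pair_left, ← hh]
          rcases eq_or_ne (h k) 0 with e | e
          · simp [e]
          · field_simp
      _ ≤ _ := le_rfl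
  have key := shannon_le_of_sum_le (p := r) (q := q) (law_nonneg hp _)
    (fun s => div_nonneg (mul_nonneg (f0 _) (g0 _)) (h0 _))
    (fun s hs => by
      rcases div_eq_zero_iff.1 hs with hs | hs
      · rcases mul_eq_zero.1 hs with hs | hs
        · exact rf s hs
        · exact rg s hs
      · exact rh s hs) hq
  have e2 : ∑ s, r s * (-Real.log (q s) / Real.log 2)
      = ∑ s, r s * (-Real.log (f (s.1, s.2.2)) / Real.log 2)
        + ∑ s, r s * (-Real.log (g (s.2.1, s.2.2)) / Real.log 2)
        - ∑ s, r s * (-Real.log (h s.2.2) / Real.log 2) := by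
    rw [← Finset.sum_add_distrib, ← Finset.sum_sub_distrib]
    refine Finset.sum_congr rfl fun s _ => ?_
    by_cases hs : r s = 0
    · simp [hs]
    have h1 : f (s.1, s.2.2) ≠ 0 := fun h' => hs (rf s h')
    have h2 : g (s.2.1, s.2.2) ≠ 0 := fun h' => hs (rg s h')
    have h3 : h s.2.2 ≠ 0 := fun h' => hs (rh s h')
    simp only [q]
    rw [Real.log_div (mul_ne_zero h1 h2) h3, Real.log_mul h1 h2]
    ring
  rw [e2, hr, sum_law_mul, sum_law_mul, sum_law_mul] at key
  rw [entropy_eq_shannon p fun ω => (a ω, b ω, c ω), entropy_eq_sum p c,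
    entropy_eq_sum p fun ω => (a ω, c ω), entropy_eq_sum p fun ω => (b ω, c ω)]
  linarith

/-- Conditioning reduces entropy: `c` is a function of `b`. -/
theorem entropy_sub_le_of_determines {p : Ω → ℝ} (hp : ∀ ω, 0 ≤ p ω) (a : Ω → A) (b : Ω → B)
    (c : Ω → C) (h : ∀ ω ω', b ω = b ω' → c ω = c ω') :
    entropy p (fun ω => (b ω, a ω)) - entropy p b
      ≤ entropy p (fun ω => (c ω, a ω)) - entropy p c := by
  have h1 := entropy_submodular hp a b c
  have e1 : entropy p (fun ω => (a ω, b ω, c ω)) = entropy p (fun ω => (b ω, a ω)) := by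
    refine entropy_congr p fun ω ω' => ?_
    simp only [Prod.mk.injEq]
    have := h ω ω'
    tauto
  have e2 : entropy p (fun ω => (b ω, c ω)) = entropy p b := by
    refine entropy_congr p fun ω ω' => ?_
    simp only [Prod.mk.injEq]
    have := h ω ω'
    tauto
  have e3 : entropy p (fun ω => (a ω, c ω)) = entropy p (fun ω => (c ω, a ω)) := by
    refine entropy_congr p fun ω ω' => ?_
    simp only [Prod.mk.injEq]
    tauto
  linarith

theorem entropy_const {p : Ω → ℝ} (hp : ∑ ω, p ω = 1) {a : Ω → A} (h : ∀ ω ω', a ω = a ω') :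
    entropy p a = 0 := by
  rw [entropy_eq_sum]
  refine Finset.sum_eq_zero fun ω _ => ?_
  have : law p a (a ω) = 1 := by
    rw [law, Finset.filter_true_of_mem fun ω' _ => h ω' ω, hp]
  simp [this]

theorem entropy_of_uniform {p : Ω → ℝ} (hp : ∑ ω, p ω = 1) {a : Ω → A} {m : ℝ}
    (h : ∀ s, law p a s = 1 / m) : entropy p a = Real.logb 2 m := by
  rw [entropy_eq_sum]
  simp only [h]
  rw [← Finset.sum_mul, hp, one_div, Real.log_inv, Real.logb]
  ring

/-- The chain rule, with the conditional law given by a kernel. -/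
theorem entropy_pair_of_kernel {p : Ω → ℝ} {a : Ω → A} {b : Ω → B} {r : A → ℝ} {κ : A → B → ℝ}
    (hκ : ∀ s, ∑ t, κ s t = 1)
    (h : ∀ s t, law p (fun ω => (a ω, b ω)) (s, t) = r s * κ s t) :
    entropy p (fun ω => (a ω, b ω)) - entropy p a = ∑ s, r s * shannon (κ s) := by
  have hr : law p a = r := by
    funext s
    rw [← sum_law_pair_right p a b s]
    simp only [h]
    rw [← Finset.mul_sum, hκ, mul_one]
  rw [entropy_eq_shannon, entropy_eq_shannon, hr, shannon, shannon, Fintype.sum_prod_type,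
    ← Finset.sum_sub_distrib]
  refine Finset.sum_congr rfl fun s _ => ?_
  simp only [h, Real.negMulLog_mul]
  rw [← Finset.sum_div, Finset.sum_add_distrib, ← Finset.sum_mul, hκ, ← Finset.mul_sum, shannon,
    ← Finset.sum_div]
  ring

/-- Fano's inequality. -/
theorem fano {p : Ω → ℝ} (hp : p ∈ stdSimplex ℝ Ω) (a : Ω → A) (b : Ω → B) (g : B → Option A)
    [Nonempty A] :
    entropy p (fun ω => (a ω, b ω)) - entropy p b
      ≤ 1 + (∑ ω, if g (b ω) ≠ some (a ω) then p ω else 0) * Real.logb 2 (Fintype.card A) := by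
  have hl := log_two_pos
  obtain ⟨m, hm⟩ : ∃ m : ℝ, m = Fintype.card A := ⟨_, rfl⟩
  rw [← hm]
  have hm0 : 0 < m := by rw [hm]; exact_mod_cast Fintype.card_pos
  -- Half of the conditional mass goes to the decoded value and half is spread uniformly over `A`. A
  -- correct decision then costs at most one bit and an error costs $1+\log_2 m$ bits, so no binary
  -- entropy term is needed.
  let q : A × B → ℝ := fun s =>
    law p b s.2 * ((if g s.2 = some s.1 then 1 / 2 else 0) + 1 / (2 * m))
  have qpos : ∀ s : A × B, 0 < (if g s.2 = some s.1 then (1 / 2 : ℝ) else 0) + 1 / (2 * m) := by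
    intro s
    have : 0 < 1 / (2 * m) := by positivity
    split_ifs <;> linarith
  have hq : ∑ s, q s ≤ ∑ s, law p (fun ω => (a ω, b ω)) s := by
    rw [sum_law, ← sum_law p b, Fintype.sum_prod_type_right]
    refine Finset.sum_le_sum fun t _ => ?_
    simp only [q]
    rw [← Finset.mul_sum]
    refine mul_le_of_le_one_right (law_nonneg hp.1 b t) ?_
    rw [Finset.sum_add_distrib, Finset.sum_const, Finset.card_univ, nsmul_eq_mul, ← hm]
    have h1 : ∑ x, (if g t = some x then (1 / 2 : ℝ) else 0) ≤ 1 / 2 := by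
      cases g t with
      | none => simp
      | some y => simp
    have h2 : m * (1 / (2 * m)) = 1 / 2 := by field_simp
    linarith
  have key := shannon_le_of_sum_le (p := law p fun ω => (a ω, b ω)) (q := q) (law_nonneg hp.1 _)
    (fun s => mul_nonneg (law_nonneg hp.1 b s.2) (qpos s).le)
    (fun s hs => by
      rcases mul_eq_zero.1 hs with hs | hs
      · exact law_eq_zero_of_comp hp.1 (a := fun ω => (a ω, b ω)) (fun t => t.2) hs
      · exact absurd hs (qpos s).ne') hq
  rw [sum_law_mul p (fun ω => (a ω, b ω)) fun s => -Real.log (q s) / Real.log 2] at key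
  rw [entropy_eq_shannon p fun ω => (a ω, b ω), entropy_eq_sum p b]
  rw [sub_le_iff_le_add, ← hp.2, Finset.sum_mul, ← Finset.sum_add_distrib,
    ← Finset.sum_add_distrib]
  refine key.trans ?_
  refine Finset.sum_le_sum fun ω _ => ?_
  rcases (hp.1 ω).eq_or_lt with h0 | h0
  · simp [← h0]
  have hb : 0 < law p b (b ω) :=
    h0.trans_le (Finset.single_le_sum (fun ω _ => hp.1 ω) (by simp))
  simp only [q]
  rw [Real.log_mul hb.ne' (qpos (a ω, b ω)).ne', neg_add, add_div, mul_add, add_comm]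
  refine add_le_add_left ?_ _
  by_cases hg : g (b ω) = some (a ω)
  · simp only [hg, if_true, ne_eq, not_true_eq_false, if_false, zero_mul, add_zero]
    refine mul_le_of_le_one_right h0.le ?_
    rw [div_le_one hl, neg_le, ← Real.log_inv]
    refine Real.log_le_log (by norm_num) ?_
    have : 0 < 1 / (2 * m) := by positivity
    linarith
  · simp only [hg, if_false, ne_eq, not_false_eq_true, if_true, zero_add]
    rw [one_div, Real.log_inv, neg_neg, Real.log_mul two_ne_zero hm0.ne', Real.logb, add_div,
      div_self hl.ne', mul_add, mul_one]

end Information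

/-! ### Carathéodory's theorem and compactness of convex hulls -/

section Caratheodory

variable {E : Type*} [AddCommGroup E] [Module ℝ E]

/-- Carathéodory's theorem with an index type of fixed size. -/
theorem exists_fin_of_mem_convexHull [FiniteDimensional ℝ E] {s : Set E} {x : E} {n : ℕ}
    (hn : Module.finrank ℝ E + 1 ≤ n) (hx : x ∈ convexHull ℝ s) :
    ∃ w ∈ stdSimplex ℝ (Fin n), ∃ z : Fin n → E, (∀ i, z i ∈ s) ∧ ∑ i, w i • z i = x := by
  obtain ⟨x₀, hx₀⟩ : s.Nonempty := convexHull_nonempty_iff.1 ⟨x, hx⟩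
  obtain ⟨ι, _, z, w, hz, hi, hw, hw1, hsum⟩ := eq_pos_convex_span_of_mem_convexHull hx
  have hcard : Fintype.card ι ≤ Fintype.card (Fin n) := by
    rw [Fintype.card_fin]
    exact (hi.card_le_finrank_succ.trans (Nat.succ_le_succ (Submodule.finrank_le _))).trans hn
  obtain ⟨f⟩ := Function.Embedding.nonempty_of_card_le hcard
  -- Surplus indices receive weight 0 and the arbitrary point `x₀` of `s`.
  have hw0 : ∀ i ∉ Set.range f, Function.extend f w 0 i = 0 := fun i hi =>
    Function.extend_apply' _ _ _ fun ⟨a, ha⟩ => hi ⟨a, ha⟩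
  refine ⟨Function.extend f w 0, ⟨fun i => ?_, ?_⟩, Function.extend f z fun _ => x₀, fun i => ?_, ?_⟩
  · by_cases h : i ∈ Set.range f
    · obtain ⟨a, rfl⟩ := h
      rw [f.injective.extend_apply]
      exact (hw a).le
    · rw [hw0 i h]
  · rw [← hw1]
    exact (Fintype.sum_of_injective f f.injective _ _ hw0
      fun i => (f.injective.extend_apply _ _ i).symm).symm
  · by_cases h : i ∈ Set.range f
    · obtain ⟨a, rfl⟩ := h
      rw [f.injective.extend_apply]
      exact hz ⟨a, rfl⟩
    · rw [Function.extend_apply' _ _ _ fun ⟨a, ha⟩ => h ⟨a, ha⟩]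
      exact hx₀
  · rw [← hsum]
    refine (Fintype.sum_of_injective f f.injective _ _ (fun i hi => ?_) fun i => ?_).symm
    · rw [hw0 i hi, zero_smul]
    · rw [f.injective.extend_apply, f.injective.extend_apply]

/-- By Carathéodory, boundedly many points suffice, so the hull is the continuous image of a compact
set of weights and points. -/
theorem isCompact_convexHull_of_isCompact [FiniteDimensional ℝ E] [TopologicalSpace E]
    [IsTopologicalAddGroup E] [ContinuousSMul ℝ E] {s : Set E} (hs : IsCompact s) :
    IsCompact (convexHull ℝ s) := by
  have : convexHull ℝ s = (fun k : (Fin (Module.finrank ℝ E + 1) → ℝ) ×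
        (Fin (Module.finrank ℝ E + 1) → E) => ∑ i, k.1 i • k.2 i) ''
      (stdSimplex ℝ (Fin (Module.finrank ℝ E + 1)) ×ˢ Set.univ.pi fun _ => s) := by
    ext x
    constructor
    · intro hx
      obtain ⟨w, hw, z, hz, rfl⟩ := exists_fin_of_mem_convexHull le_rfl hx
      exact ⟨(w, z), ⟨hw, fun i _ => hz i⟩, rfl⟩
    · rintro ⟨⟨w, z⟩, ⟨hw, hz⟩, rfl⟩
      exact mem_convexHull_of_exists_fintype w z hw.1 hw.2 (fun i => hz i trivial) rfl
  rw [this]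
  refine ((isCompact_stdSimplex ℝ _).prod (isCompact_univ_pi fun _ => hs)).image ?_
  fun_prop

end Caratheodory

/-! ### Output entropies of a channel and the entropy hull -/

section Channel

variable {X B C : Type*} [Fintype X] [Fintype B] [Fintype C]

theorem continuous_shannon : Continuous (shannon : (B → ℝ) → ℝ) := by
  unfold shannon
  exact continuous_finsetSum _ fun s _ =>
    (Real.continuous_negMulLog.comp (continuous_apply s)).div_const _

theorem le_shannon_sum {ι : Type*} [Fintype ι] {w : ι → ℝ} (hw : w ∈ stdSimplex ℝ ι)
    {f : ι → B → ℝ} (hf : ∀ i t, 0 ≤ f i t) :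
    ∑ i, w i * shannon (f i) ≤ shannon fun t => ∑ i, w i * f i t := by
  simp only [shannon, Finset.mul_sum]
  rw [Finset.sum_comm]
  refine Finset.sum_le_sum fun t _ => ?_
  simp only [← mul_div_assoc]
  rw [← Finset.sum_div]
  refine div_le_div_of_nonneg_right ?_ log_two_pos.le
  simpa using Real.concaveOn_negMulLog.le_map_sum (t := Finset.univ) (w := w)
    (p := fun i => f i t) (fun i _ => hw.1 i) hw.2 fun i _ => hf i t

/-- The output entropy of the channel `K` for the input pmf `p`. -/
def outputEntropy (K : X → B → ℝ) (p : X → ℝ) : ℝ := shannon fun t => ∑ x, p x * K x t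

/-- The conditional entropy of the output of `K` given its input, for the input pmf `p`. -/
def noiseEntropy (K : X → B → ℝ) (p : X → ℝ) : ℝ := ∑ x, p x * shannon (K x)

theorem continuous_outputEntropy (K : X → B → ℝ) : Continuous (outputEntropy K) :=
  continuous_shannon.comp (by fun_prop)

theorem continuous_noiseEntropy (K : X → B → ℝ) : Continuous (noiseEntropy K) := by
  unfold noiseEntropy; fun_prop

theorem noiseEntropy_le_outputEntropy {K : X → B → ℝ} (hK : ∀ x, K x ∈ stdSimplex ℝ B)
    {p : X → ℝ} (hp : p ∈ stdSimplex ℝ X) : noiseEntropy K p ≤ outputEntropy K p :=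
  le_shannon_sum hp fun x t => (hK x).1 t

theorem sum_outputEntropy_le {ι : Type*} [Fintype ι] {K : X → B → ℝ}
    (hK : ∀ x, K x ∈ stdSimplex ℝ B) {w : ι → ℝ} (hw : w ∈ stdSimplex ℝ ι) {p : ι → X → ℝ}
    (hp : ∀ i, p i ∈ stdSimplex ℝ X) :
    ∑ i, w i * outputEntropy K (p i) ≤ outputEntropy K (∑ i, w i • p i) := by
  refine (le_shannon_sum hw fun i t =>
    Finset.sum_nonneg fun x _ => mul_nonneg ((hp i).1 x) ((hK x).1 t)).trans_eq ?_
  rw [outputEntropy]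
  congr 1
  funext t
  simp only [Finset.sum_apply, Pi.smul_apply, smul_eq_mul, Finset.sum_mul, Finset.mul_sum]
  rw [Finset.sum_comm]
  simp only [mul_assoc]

theorem noiseEntropy_sum {ι : Type*} [Fintype ι] (K : X → B → ℝ) (w : ι → ℝ) (p : ι → X → ℝ) :
    noiseEntropy K (∑ i, w i • p i) = ∑ i, w i * noiseEntropy K (p i) := by
  simp only [noiseEntropy, Finset.sum_apply, Pi.smul_apply, smul_eq_mul, Finset.sum_mul,
    Finset.mul_sum]
  rw [Finset.sum_comm]
  simp only [mul_assoc]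

/-- The triples `(E p, E H_K(p), E H_L(p))` for a random input pmf `p` of finite support. -/
def entropyHull (K : X → B → ℝ) (L : X → C → ℝ) : Set ((X → ℝ) × ℝ × ℝ) :=
  convexHull ℝ ((fun p => (p, outputEntropy K p, outputEntropy L p)) '' stdSimplex ℝ X)

theorem isCompact_entropyHull (K : X → B → ℝ) (L : X → C → ℝ) :
    IsCompact (entropyHull K L) :=
  isCompact_convexHull_of_isCompact <| (isCompact_stdSimplex ℝ X).image <|
    continuous_id.prodMk ((continuous_outputEntropy K).prodMk (continuous_outputEntropy L))

theorem sum_mem_entropyHull {ι : Type*} [Fintype ι] {w : ι → ℝ} (hw : w ∈ stdSimplex ℝ ι)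
    {p : ι → X → ℝ} (hp : ∀ i, p i ∈ stdSimplex ℝ X) (K : X → B → ℝ) (L : X → C → ℝ) :
    (∑ i, w i • p i, ∑ i, w i * outputEntropy K (p i), ∑ i, w i * outputEntropy L (p i))
      ∈ entropyHull K L := by
  refine mem_convexHull_of_exists_fintype w
    (fun i => (p i, outputEntropy K (p i), outputEntropy L (p i))) hw.1 hw.2
    (fun i => ⟨p i, hp i, rfl⟩) ?_
  simp only [Prod.ext_iff, Prod.fst_sum, Prod.snd_sum, Prod.smul_mk, smul_eq_mul, and_self]

/-- The ambient space has dimension $|X|+2$, whence $|X|+3$ points. This number does not involve the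
channels, so it is the same for every channel index. -/
theorem exists_fin_of_mem_entropyHull {K : X → B → ℝ} {L : X → C → ℝ} {p : X → ℝ} {α β : ℝ}
    (h : (p, α, β) ∈ entropyHull K L) :
    ∃ w ∈ stdSimplex ℝ (Fin (Fintype.card X + 3)), ∃ q : Fin (Fintype.card X + 3) → X → ℝ,
      (∀ i, q i ∈ stdSimplex ℝ X) ∧ ∑ i, w i • q i = p ∧
      ∑ i, w i * outputEntropy K (q i) = α ∧ ∑ i, w i * outputEntropy L (q i) = β := by
  have hd : Module.finrank ℝ ((X → ℝ) × ℝ × ℝ) + 1 ≤ Fintype.card X + 3 := by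
    simp [Module.finrank_prod]
  obtain ⟨w, hw, z, hz, hs⟩ := exists_fin_of_mem_convexHull hd h
  choose q hq hqz using hz
  refine ⟨w, hw, q, hq, ?_⟩
  simpa only [Prod.ext_iff, Prod.fst_sum, Prod.snd_sum, ← hqz, Prod.smul_mk, smul_eq_mul] using hs

theorem mem_stdSimplex_of_mem_entropyHull {K : X → B → ℝ} {L : X → C → ℝ}
    {k : (X → ℝ) × ℝ × ℝ} (h : k ∈ entropyHull K L) : k.1 ∈ stdSimplex ℝ X := by
  have hc : Convex ℝ {k : (X → ℝ) × ℝ × ℝ | k.1 ∈ stdSimplex ℝ X} :=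
    (convex_stdSimplex ℝ X).is_linear_preimage (IsLinearMap.mk (fun _ _ => rfl) fun _ _ => rfl)
  refine convexHull_min ?_ hc h
  rintro _ ⟨p, hp, rfl⟩
  exact hp

end Channel

/-! ### From random variables to points of the entropy hull -/

section RandomVariables

variable {Ω A X B C : Type*} [Fintype Ω] [Fintype A] [DecidableEq A] [Fintype X] [DecidableEq X]
  [Fintype B] [DecidableEq B] [Fintype C] [DecidableEq C]

theorem sum_output {K : X → B → ℝ} (hK : ∀ x, K x ∈ stdSimplex ℝ B) (p : X → ℝ) :
    ∑ t, ∑ x, p x * K x t = ∑ x, p x := by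
  rw [Finset.sum_comm]
  simp only [← Finset.mul_sum, (hK _).2, mul_one]

theorem entropy_of_law {P : Ω → ℝ} {b : Ω → B} {p : X → ℝ} {K : X → B → ℝ}
    (h : ∀ t, law P b t = ∑ x, p x * K x t) : entropy P b = outputEntropy K p := by
  rw [entropy_eq_shannon, outputEntropy]
  exact congrArg shannon (funext h)

theorem entropy_output {P : Ω → ℝ} {a : Ω → A} {b : Ω → B} {r : A → ℝ} {q : A → X → ℝ}
    {K : X → B → ℝ} (hK : ∀ x, K x ∈ stdSimplex ℝ B) (hq : ∀ s, q s ∈ stdSimplex ℝ X)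
    (h : ∀ s t, law P (fun ω => (a ω, b ω)) (s, t) = r s * ∑ x, q s x * K x t) :
    entropy P (fun ω => (a ω, b ω)) - entropy P a = ∑ s, r s * outputEntropy K (q s) :=
  entropy_pair_of_kernel (κ := fun s t => ∑ x, q s x * K x t)
    (fun s => by rw [sum_output hK, (hq s).2]) h

/-- If `ξ` is the input of the channels `K` and `L` with outputs `b` and `c`, both memoryless
given `a`, then the conditional output entropies given `a` form a point of the hull. -/
theorem condEntropy_mem_entropyHull {P : Ω → ℝ} (hP : P ∈ stdSimplex ℝ Ω) (a : Ω → A) (ξ : Ω → X)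
    (b : Ω → B) (c : Ω → C) {K : X → B → ℝ} {L : X → C → ℝ} (hK : ∀ x, K x ∈ stdSimplex ℝ B)
    (hL : ∀ x, L x ∈ stdSimplex ℝ C)
    (hb : ∀ s t, law P (fun ω => (a ω, b ω)) (s, t)
      = ∑ x, law P (fun ω => (a ω, ξ ω)) (s, x) * K x t)
    (hc : ∀ s t, law P (fun ω => (a ω, c ω)) (s, t)
      = ∑ x, law P (fun ω => (a ω, ξ ω)) (s, x) * L x t) :
    (law P ξ, entropy P (fun ω => (a ω, b ω)) - entropy P a,
      entropy P (fun ω => (a ω, c ω)) - entropy P a) ∈ entropyHull K L := by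
  set r := law P a with hr
  -- The conditional law of the input given `a`. On null values of `a` any pmf would do; the law of
  -- `ξ` is at hand.
  let q : A → X → ℝ := fun s => if r s = 0 then law P ξ else
    fun x => law P (fun ω => (a ω, ξ ω)) (s, x) / r s
  have hrs : ∀ s, ∑ x, law P (fun ω => (a ω, ξ ω)) (s, x) = r s := sum_law_pair_right P a ξ
  have hq : ∀ s, q s ∈ stdSimplex ℝ X := by
    intro s
    by_cases h : r s = 0
    · simp only [q, h, if_true]
      exact law_mem_stdSimplex hP ξ
    · simp only [q, h, if_false]
      refine ⟨fun x => div_nonneg (law_nonneg hP.1 _ _) (law_nonneg hP.1 _ _), ?_⟩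
      rw [← Finset.sum_div, hrs, div_self h]
  have hjoint : ∀ s x, law P (fun ω => (a ω, ξ ω)) (s, x) = r s * q s x := by
    intro s x
    by_cases h : r s = 0
    · rw [h, zero_mul]
      exact law_eq_zero_of_comp hP.1 (a := fun ω => (a ω, ξ ω)) Prod.fst h
    · simp only [q, h, if_false]
      field_simp
  rw [entropy_output hK hq (r := r) fun s t => by simp only [hb, hjoint, Finset.mul_sum, mul_assoc],
    entropy_output hL hq (r := r) fun s t => by simp only [hc, hjoint, Finset.mul_sum, mul_assoc]]
  have : law P ξ = ∑ s, r s • q s := by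
    funext x
    rw [← sum_law_pair_left P a ξ x]
    simp [hjoint]
  rw [this]
  exact sum_mem_entropyHull (law_mem_stdSimplex hP a) hq K L

end RandomVariables

/-! ### Past, future and the Csiszár-type sum identity -/

section Telescoping

variable {Ω A Y Z : Type*} {n : ℕ} [Fintype Ω] [Fintype A] [DecidableEq A]
  [Fintype Y] [DecidableEq Y] [Fintype Z] [DecidableEq Z]

/-- The coordinates of index less than `k`. -/
def initialPart (y : Ω → Fin n → Y) (k : ℕ) (ω : Ω) : {j : Fin n // j.1 < k} → Y := fun j => y ω j

/-- The coordinates of index at least `k`. -/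
def finalPart (z : Ω → Fin n → Z) (k : ℕ) (ω : Ω) : {j : Fin n // k ≤ j.1} → Z := fun j => z ω j

/-- The values of `pastFuture` at index `i`. -/
def PastFuture (A Y Z : Type*) {n : ℕ} (i : Fin n) : Type _ :=
  A × ({j : Fin n // j.1 < i.1} → Y) × ({j : Fin n // i.1 + 1 ≤ j.1} → Z)

instance (i : Fin n) : Fintype (PastFuture A Y Z i) :=
  inferInstanceAs (Fintype (A × ({j : Fin n // j.1 < i.1} → Y) × ({j : Fin n // i.1 + 1 ≤ j.1} → Z)))

instance (i : Fin n) : DecidableEq (PastFuture A Y Z i) := Classical.decEq _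

/-- The random variable `w` with the past of `y` and the future of `z` at index `i`. -/
def pastFuture (w : Ω → A) (y : Ω → Fin n → Y) (z : Ω → Fin n → Z) (i : Fin n) (ω : Ω) :
    PastFuture A Y Z i :=
  (w ω, initialPart y i ω, finalPart z (i + 1) ω)

theorem initialPart_eq_iff (y : Ω → Fin n → Y) (k : ℕ) (ω ω' : Ω) :
    initialPart y k ω = initialPart y k ω' ↔ ∀ j : Fin n, j.1 < k → y ω j = y ω' j := by
  simp [initialPart, funext_iff]

theorem finalPart_eq_iff (z : Ω → Fin n → Z) (k : ℕ) (ω ω' : Ω) :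
    finalPart z k ω = finalPart z k ω' ↔ ∀ j : Fin n, k ≤ j.1 → z ω j = z ω' j := by
  simp [finalPart, funext_iff]

theorem initialPart_succ_eq_iff (y : Ω → Fin n → Y) (i : Fin n) (ω ω' : Ω) :
    initialPart y (i + 1) ω = initialPart y (i + 1) ω' ↔
      initialPart y i ω = initialPart y i ω' ∧ y ω i = y ω' i := by
  simp only [initialPart_eq_iff]
  refine ⟨fun h => ⟨fun j hj => h j (by omega), h i (by omega)⟩, fun h j hj => ?_⟩
  rcases Nat.lt_succ_iff_lt_or_eq.1 hj with hj | hj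
  · exact h.1 j hj
  · rw [Fin.ext hj]; exact h.2

theorem finalPart_eq_succ_iff (z : Ω → Fin n → Z) (i : Fin n) (ω ω' : Ω) :
    finalPart z i ω = finalPart z i ω' ↔
      finalPart z (i + 1) ω = finalPart z (i + 1) ω' ∧ z ω i = z ω' i := by
  simp only [finalPart_eq_iff]
  refine ⟨fun h => ⟨fun j hj => h j (by omega), h i le_rfl⟩, fun h j hj => ?_⟩
  rcases hj.lt_or_eq with hj | hj
  · exact h.1 j hj
  · rw [← Fin.ext hj]; exact h.2

theorem initialPart_full_eq_iff (y : Ω → Fin n → Y) (ω ω' : Ω) :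
    initialPart y n ω = initialPart y n ω' ↔ y ω = y ω' := by
  rw [initialPart_eq_iff, funext_iff]; simp

theorem finalPart_zero_eq_iff (z : Ω → Fin n → Z) (ω ω' : Ω) :
    finalPart z 0 ω = finalPart z 0 ω' ↔ z ω = z ω' := by
  rw [finalPart_eq_iff, funext_iff]; simp

theorem initialPart_zero_eq (y : Ω → Fin n → Y) (ω ω' : Ω) :
    initialPart y 0 ω = initialPart y 0 ω' := by
  simp [initialPart_eq_iff]

theorem finalPart_full_eq (z : Ω → Fin n → Z) (ω ω' : Ω) :
    finalPart z n ω = finalPart z n ω' := by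
  rw [finalPart_eq_iff]; intro j; omega

theorem pastFuture_eq_iff (w : Ω → A) (y : Ω → Fin n → Y) (z : Ω → Fin n → Z) (i : Fin n)
    (ω ω' : Ω) : pastFuture w y z i ω = pastFuture w y z i ω' ↔
      w ω = w ω' ∧ initialPart y i ω = initialPart y i ω' ∧
        finalPart z (i + 1) ω = finalPart z (i + 1) ω' :=
  Prod.ext_iff.trans (and_congr Iff.rfl Prod.ext_iff)

theorem sum_fin_sub (f : ℕ → ℝ) (n : ℕ) : ∑ i : Fin n, (f (i + 1) - f i) = f n - f 0 := by
  rw [Fin.sum_univ_eq_sum_range fun i => f (i + 1) - f i, Finset.sum_range_sub]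

variable {p : Ω → ℝ}

/-- With $f(k)=H(w,Y_{<k},Z_{\ge k})$, both sides are $f(0)-f(n)$: passing from $k=i$ to $i+1$
exchanges $Z_i$ for $Y_i$ while the rest stays `pastFuture`. Being an equality, it can later be
combined with bounds in either direction. -/
theorem entropy_sub_entropy_eq_sum (p : Ω → ℝ) (w : Ω → A) (y : Ω → Fin n → Y)
    (z : Ω → Fin n → Z) :
    entropy p (fun ω => (w ω, z ω)) - entropy p (fun ω => (w ω, y ω))
      = ∑ i : Fin n, (entropy p (fun ω => (pastFuture w y z i ω, z ω i))
        - entropy p (fun ω => (pastFuture w y z i ω, y ω i))) := by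
  let f : ℕ → ℝ := fun k => entropy p fun ω => (w ω, initialPart y k ω, finalPart z k ω)
  have h0 : entropy p (fun ω => (w ω, z ω)) = f 0 := entropy_congr p fun ω ω' => by
    simp only [Prod.mk.injEq, finalPart_zero_eq_iff]
    have := initialPart_zero_eq y ω ω'
    tauto
  have hn : entropy p (fun ω => (w ω, y ω)) = f n := entropy_congr p fun ω ω' => by
    simp only [Prod.mk.injEq, initialPart_full_eq_iff]
    have := finalPart_full_eq z ω ω'
    tauto
  rw [h0, hn, ← neg_sub, ← sum_fin_sub, ← Finset.sum_neg_distrib]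
  refine Finset.sum_congr rfl fun i _ => ?_
  rw [neg_sub]
  congr 1 <;> refine entropy_congr p fun ω ω' => ?_
  · simp only [pastFuture_eq_iff, Prod.mk.injEq, finalPart_eq_succ_iff]
    tauto
  · simp only [pastFuture_eq_iff, Prod.mk.injEq, initialPart_succ_eq_iff]
    tauto

/-- Forgetting the future of `z` in the conditioning can only increase each term, and what is left
is the chain rule for `y` given `w`. -/
theorem sum_condEntropy_past_le (hp : ∀ ω, 0 ≤ p ω) (w : Ω → A) (y : Ω → Fin n → Y)
    (z : Ω → Fin n → Z) :
    ∑ i : Fin n, (entropy p (fun ω => (pastFuture w y z i ω, y ω i)) - entropy p (pastFuture w y z i))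
      ≤ entropy p (fun ω => (w ω, y ω)) - entropy p w := by
  let f : ℕ → ℝ := fun k => entropy p fun ω => (w ω, initialPart y k ω)
  have h0 : entropy p w = f 0 := entropy_congr p fun ω ω' => by
    simp only [Prod.mk.injEq]
    have := initialPart_zero_eq y ω ω'
    tauto
  have hn : entropy p (fun ω => (w ω, y ω)) = f n := entropy_congr p fun ω ω' => by
    simp only [Prod.mk.injEq, initialPart_full_eq_iff]
  rw [h0, hn, ← sum_fin_sub]
  refine Finset.sum_le_sum fun i _ => ?_
  refine (entropy_sub_le_of_determines hp (fun ω => y ω i) (pastFuture w y z i)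
    (fun ω => (w ω, initialPart y i ω)) ?_).trans_eq ?_
  · simp only [pastFuture_eq_iff, Prod.mk.injEq]
    tauto
  · congr 1
    refine entropy_congr p fun ω ω' => ?_
    simp only [Prod.mk.injEq, initialPart_succ_eq_iff]
    tauto

theorem sum_condEntropy_future_le (hp : ∀ ω, 0 ≤ p ω) (w : Ω → A) (y : Ω → Fin n → Y)
    (z : Ω → Fin n → Z) :
    ∑ i : Fin n, (entropy p (fun ω => (pastFuture w y z i ω, z ω i)) - entropy p (pastFuture w y z i))
      ≤ entropy p (fun ω => (w ω, z ω)) - entropy p w := by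
  let f : ℕ → ℝ := fun k => entropy p fun ω => (w ω, finalPart z k ω)
  have h0 : entropy p (fun ω => (w ω, z ω)) = f 0 := entropy_congr p fun ω ω' => by
    simp only [Prod.mk.injEq, finalPart_zero_eq_iff]
  have hn : entropy p w = f n := entropy_congr p fun ω ω' => by
    simp only [Prod.mk.injEq]
    have := finalPart_full_eq z ω ω'
    tauto
  rw [h0, hn, ← neg_sub, ← sum_fin_sub, ← Finset.sum_neg_distrib]
  refine Finset.sum_le_sum fun i _ => ?_
  rw [neg_sub]
  refine (entropy_sub_le_of_determines hp (fun ω => z ω i) (pastFuture w y z i)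
    (fun ω => (w ω, finalPart z (i + 1) ω)) ?_).trans_eq ?_
  · simp only [pastFuture_eq_iff, Prod.mk.injEq]
    tauto
  · congr 1
    refine entropy_congr p fun ω ω' => ?_
    simp only [Prod.mk.injEq, finalPart_eq_succ_iff]
    tauto

theorem entropy_le_sum_entropy (hp : p ∈ stdSimplex ℝ Ω) (y : Ω → Fin n → Y) :
    entropy p y ≤ ∑ i, entropy p fun ω => y ω i := by
  let f : ℕ → ℝ := fun k => entropy p (initialPart y k)
  have h0 : f 0 = 0 := entropy_const hp.2 (initialPart_zero_eq y)
  have hn : entropy p y = f n := entropy_congr p fun ω ω' => (initialPart_full_eq_iff y ω ω').symm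
  rw [hn, ← sub_zero (f n), ← h0, ← sum_fin_sub]
  refine Finset.sum_le_sum fun i _ => ?_
  have h := entropy_sub_le_of_determines hp.1 (fun ω => y ω i) (initialPart y i) (fun _ => ())
    fun _ _ _ => rfl
  rw [entropy_const hp.2 (a := fun _ => ()) fun _ _ => rfl, sub_zero,
    entropy_congr p (a := fun ω => ((), y ω i)) (b := fun ω => y ω i) (by simp)] at h
  refine le_trans (le_of_eq ?_) h
  congr 1
  refine entropy_congr p fun ω ω' => ?_
  simp only [Prod.mk.injEq, initialPart_succ_eq_iff]

end Telescoping

/-! ### The block law of a memoryless channel -/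

section BlockLaw

variable {M X Y Z A B : Type*} {n : ℕ} [Fintype M] [Fintype X] [DecidableEq X]
  [Fintype Y] [DecidableEq Y] [Fintype Z] [DecidableEq Z] [Fintype A] [DecidableEq A]
  [Fintype B]

theorem sum_prod_eq_one {ι : Type*} [Fintype ι] [DecidableEq ι] {K : ι → B → ℝ}
    (hK : ∀ i, ∑ v, K i v = 1) : ∑ o : ι → B, ∏ k, K k (o k) = 1 := by
  have := Finset.prod_univ_sum (fun _ : ι => (Finset.univ : Finset B)) K
  rw [Fintype.piFinset_univ] at this
  rw [← this]
  simp [hK]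

/-- A coordinate of a product law is independent of the other coordinates. -/
theorem sum_mul_prod_eq {ι : Type*} [Fintype ι] [DecidableEq ι] (i : ι) {K : ι → B → ℝ}
    (hK : ∑ v, K i v = 1) {G : (ι → B) → ℝ}
    (hG : ∀ o o', (∀ k ≠ i, o k = o' k) → G o = G o') (g : B → ℝ) :
    ∑ o : ι → B, G o * g (o i) * ∏ k, K k (o k)
      = (∑ v, g v * K i v) * ∑ o : ι → B, G o * ∏ k, K k (o k) := by
  obtain ⟨v₀⟩ : Nonempty B := by
    by_contra h
    rw [not_nonempty_iff] at h
    simp at hK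
  -- The product is split into coordinate `i` and the others; `G` sees only the others.
  let e := (Equiv.funSplitAt i B).symm
  have he : ∀ v r, e (v, r) i = v := fun v r => by simp [e, Equiv.funSplitAt]
  have he' : ∀ v r (k : {k // k ≠ i}), e (v, r) k = r k := fun v r k => by
    simp [e, Equiv.funSplitAt, k.2]
  have hGe : ∀ v r, G (e (v, r)) = G (e (v₀, r)) := fun v r => hG _ _ fun k hk => by
    rw [he' v r ⟨k, hk⟩, he' v₀ r ⟨k, hk⟩]
  have hprod : ∀ v r, ∏ k, K k (e (v, r) k) = K i v * ∏ k : {k // k ≠ i}, K k (r k) := by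
    intro v r
    rw [Fintype.prod_eq_mul_prod_subtype_ne _ i, he]
    simp only [he']
  rw [← e.sum_comp, ← e.sum_comp]
  simp only [Fintype.sum_prod_type, hprod, he, hGe]
  have h1 : ∀ c : B → ℝ, ∀ d : ({k // k ≠ i} → B) → ℝ,
      ∑ v, ∑ r, c v * d r = (∑ v, c v) * ∑ r, d r := fun c d => (Finset.sum_mul_sum ..).symm
  have h2 := h1 (fun v => g v * K i v) fun r => G (e (v₀, r)) * ∏ k : {k // k ≠ i}, K k (r k)
  have h3 := h1 (fun v => K i v) fun r => G (e (v₀, r)) * ∏ k : {k // k ≠ i}, K k (r k)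
  rw [hK, one_mul] at h3
  rw [← h3] at h2
  convert h2 using 1
  · refine Finset.sum_congr rfl fun v _ => Finset.sum_congr rfl fun r _ => ?_
    ring
  · congr 1
    refine Finset.sum_congr rfl fun v _ => Finset.sum_congr rfl fun r _ => ?_
    ring

/-- The joint law of a uniform message and of the block of outputs of the memoryless channel `W`. -/
def blockLaw (W : X → Y × Z → ℝ) (enc : M → Fin n → X) : M × (Fin n → Y × Z) → ℝ :=
  fun ω => (∏ i, W (enc ω.1 i) (ω.2 i)) / Fintype.card M

/-- The channel to the first user. -/
def leftChannel (W : X → Y × Z → ℝ) (x : X) (y : Y) : ℝ := ∑ z, W x (y, z)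

/-- The channel to the second user. -/
def rightChannel (W : X → Y × Z → ℝ) (x : X) (z : Z) : ℝ := ∑ y, W x (y, z)

variable {W : X → Y × Z → ℝ}

theorem leftChannel_mem_stdSimplex (hW : ∀ x, W x ∈ stdSimplex ℝ (Y × Z)) (x : X) :
    leftChannel W x ∈ stdSimplex ℝ Y :=
  ⟨fun _ => Finset.sum_nonneg fun _ _ => (hW x).1 _, by
    rw [← (hW x).2, Fintype.sum_prod_type]; rfl⟩

theorem rightChannel_mem_stdSimplex (hW : ∀ x, W x ∈ stdSimplex ℝ (Y × Z)) (x : X) :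
    rightChannel W x ∈ stdSimplex ℝ Z :=
  ⟨fun _ => Finset.sum_nonneg fun _ _ => (hW x).1 _, by
    rw [← (hW x).2, Fintype.sum_prod_type_right]; rfl⟩

theorem sum_blockLaw_right (hW : ∀ x, W x ∈ stdSimplex ℝ (Y × Z)) (enc : M → Fin n → X) (m : M) :
    ∑ o, blockLaw W enc (m, o) = 1 / Fintype.card M := by
  simp only [blockLaw]
  rw [← Finset.sum_div, sum_prod_eq_one fun i => (hW (enc m i)).2]

theorem blockLaw_mem_stdSimplex [Nonempty M] (hW : ∀ x, W x ∈ stdSimplex ℝ (Y × Z))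
    (enc : M → Fin n → X) : blockLaw W enc ∈ stdSimplex ℝ (M × (Fin n → Y × Z)) := by
  refine ⟨fun ω => div_nonneg (Finset.prod_nonneg fun i _ => (hW _).1 _) (Nat.cast_nonneg _), ?_⟩
  rw [Fintype.sum_prod_type]
  simp [sum_blockLaw_right hW]

theorem law_message (hW : ∀ x, W x ∈ stdSimplex ℝ (Y × Z)) (enc : M → Fin n → X) (w : M → A)
    (s : A) : law (blockLaw W enc) (fun ω => w ω.1) s
      = (∑ m, if w m = s then 1 else 0) / (Fintype.card M : ℝ) := by
  rw [law_eq_sum_ite, Fintype.sum_prod_type, Finset.sum_div]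
  refine Finset.sum_congr rfl fun m _ => ?_
  by_cases h : w m = s
  · simp [h, sum_blockLaw_right hW]
  · simp [h]

/-- Memorylessness: given the input at time `i`, the output at time `i` is independent of the
messages and of the outputs at other times. -/
theorem law_memoryless (hW : ∀ x, W x ∈ stdSimplex ℝ (Y × Z)) (enc : M → Fin n → X) (i : Fin n)
    {a : M × (Fin n → Y × Z) → A}
    (ha : ∀ m o o', (∀ k ≠ i, o k = o' k) → a (m, o) = a (m, o')) (s : A) (t : Y × Z) :
    law (blockLaw W enc) (fun ω => (a ω, ω.2 i)) (s, t)
      = ∑ x, law (blockLaw W enc) (fun ω => (a ω, enc ω.1 i)) (s, x) * W x t := by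
  simp only [law_eq_sum_ite, Finset.sum_mul, Prod.mk.injEq]
  rw [Finset.sum_comm]
  have hR : ∀ ω : M × (Fin n → Y × Z),
      ∑ x, (if a ω = s ∧ enc ω.1 i = x then blockLaw W enc ω else 0) * W x t
        = if a ω = s then blockLaw W enc ω * W (enc ω.1 i) t else 0 := by
    intro ω
    by_cases h : a ω = s <;> simp [h, ite_mul]
  simp only [hR, Fintype.sum_prod_type]
  refine Finset.sum_congr rfl fun m _ => ?_
  -- For a fixed message the outputs have a product law, and the event `a = s` does not involve
  -- coordinate `i`.
  have key := sum_mul_prod_eq i (K := fun k => W (enc m k)) (hW (enc m i)).2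
    (G := fun o => if a (m, o) = s then 1 / (Fintype.card M : ℝ) else 0)
    (fun o o' h => by rw [ha m o o' h]) fun v => if v = t then 1 else 0
  simp only [ite_mul, one_mul, zero_mul, Finset.sum_ite_eq', Finset.mem_univ, if_true] at key
  rw [Finset.mul_sum] at key
  convert key using 1
  · refine Finset.sum_congr rfl fun o _ => ?_
    by_cases h : a (m, o) = s <;> by_cases h' : o i = t <;> simp [h, h', blockLaw]
    ring
  · refine Finset.sum_congr rfl fun o _ => ?_
    by_cases h : a (m, o) = s <;> simp [h, blockLaw]
    ring

theorem law_memoryless_left (hW : ∀ x, W x ∈ stdSimplex ℝ (Y × Z)) (enc : M → Fin n → X)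
    (i : Fin n) {a : M × (Fin n → Y × Z) → A}
    (ha : ∀ m o o', (∀ k ≠ i, o k = o' k) → a (m, o) = a (m, o')) (s : A) (t : Y) :
    law (blockLaw W enc) (fun ω => (a ω, (ω.2 i).1)) (s, t)
      = ∑ x, law (blockLaw W enc) (fun ω => (a ω, enc ω.1 i)) (s, x) * leftChannel W x t := by
  have h : law (blockLaw W enc) (fun ω => (a ω, (ω.2 i).1)) (s, t)
      = ∑ z, law (blockLaw W enc) (fun ω => (a ω, ω.2 i)) (s, (t, z)) := by
    rw [← sum_law_pair_right _ _ fun ω => (ω.2 i).2]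
    refine Finset.sum_congr rfl fun z _ => ?_
    simp only [law_eq_sum_ite, Prod.ext_iff, and_assoc]
  simp only [h, law_memoryless hW enc i ha, leftChannel, Finset.mul_sum]
  exact Finset.sum_comm

theorem law_memoryless_right (hW : ∀ x, W x ∈ stdSimplex ℝ (Y × Z)) (enc : M → Fin n → X)
    (i : Fin n) {a : M × (Fin n → Y × Z) → A}
    (ha : ∀ m o o', (∀ k ≠ i, o k = o' k) → a (m, o) = a (m, o')) (s : A) (t : Z) :
    law (blockLaw W enc) (fun ω => (a ω, (ω.2 i).2)) (s, t)
      = ∑ x, law (blockLaw W enc) (fun ω => (a ω, enc ω.1 i)) (s, x) * rightChannel W x t := by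
  have h : law (blockLaw W enc) (fun ω => (a ω, (ω.2 i).2)) (s, t)
      = ∑ y, law (blockLaw W enc) (fun ω => (a ω, ω.2 i)) (s, (y, t)) := by
    rw [← sum_law_pair_left _ fun ω => (ω.2 i).1]
    refine Finset.sum_congr rfl fun y _ => ?_
    simp only [law_eq_sum_ite, Prod.ext_iff]
    refine Finset.sum_congr rfl fun ω _ => if_congr (by tauto) rfl rfl
  simp only [h, law_memoryless hW enc i ha, rightChannel, Finset.mul_sum]
  exact Finset.sum_comm

end BlockLaw

/-! ### Single-letter converse and passage to the limit -/

section SingleLetter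

variable {M X Y Z A : Type*} {n : ℕ} [Fintype M] [Fintype X] [DecidableEq X]
  [Fintype Y] [DecidableEq Y] [Fintype Z] [DecidableEq Z] [Fintype A] [DecidableEq A]
  {W : X → Y × Z → ℝ}

/-- Output entropy dominates noise entropy for each component of the mixture, by concavity, and
noise entropy is linear in the input pmf. -/
theorem noiseEntropy_le_of_mem_entropyHull {K : X → Y → ℝ} {L : X → Z → ℝ}
    (hK : ∀ x, K x ∈ stdSimplex ℝ Y) (hL : ∀ x, L x ∈ stdSimplex ℝ Z) {p : X → ℝ} {α β : ℝ}
    (h : (p, α, β) ∈ entropyHull K L) : noiseEntropy K p ≤ α ∧ noiseEntropy L p ≤ β := by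
  obtain ⟨w, hw, q, hq, rfl, rfl, rfl⟩ := exists_fin_of_mem_entropyHull h
  rw [noiseEntropy_sum, noiseEntropy_sum]
  exact ⟨Finset.sum_le_sum fun i _ =>
      mul_le_mul_of_nonneg_left (noiseEntropy_le_outputEntropy hK (hq i)) (hw.1 i),
    Finset.sum_le_sum fun i _ =>
      mul_le_mul_of_nonneg_left (noiseEntropy_le_outputEntropy hL (hq i)) (hw.1 i)⟩

/-- The law of the channel input at a uniformly distributed time. -/
def inputType (W : X → Y × Z → ℝ) (enc : M → Fin n → X) : X → ℝ :=
  ∑ i : Fin n, (1 / n : ℝ) • law (blockLaw W enc) fun ω => enc ω.1 i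

theorem uniform_mem_stdSimplex (hn : 0 < n) :
    (fun _ : Fin n => (1 / n : ℝ)) ∈ stdSimplex ℝ (Fin n) :=
  ⟨fun _ => by positivity, by simp; field_simp⟩

/-- Index `i` lies in neither the past nor the future, which is what memorylessness at time `i`
requires. -/
theorem pastFuture_forget (w : M → A) (i : Fin n) (m : M) (o o' : Fin n → Y × Z)
    (h : ∀ k ≠ i, o k = o' k) :
    pastFuture (fun ω : M × (Fin n → Y × Z) => w ω.1) (fun ω j => (ω.2 j).1)
        (fun ω j => (ω.2 j).2) i (m, o)
      = pastFuture (fun ω : M × (Fin n → Y × Z) => w ω.1) (fun ω j => (ω.2 j).1)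
        (fun ω j => (ω.2 j).2) i (m, o') := by
  rw [pastFuture_eq_iff, initialPart_eq_iff, finalPart_eq_iff]
  refine ⟨rfl, fun j hj => ?_, fun j hj => ?_⟩
  · exact congrArg Prod.fst (h j (by rintro rfl; omega))
  · exact congrArg Prod.snd (h j (by rintro rfl; omega))

/-- The point is the time average of the conditional output entropies given `pastFuture`; convexity
plays the role of a time-sharing variable. Its first component does not depend on `w`, so different
choices of `w` give points over one input pmf. The two inequalities lose information, but the
difference is exact, and the sum-rate constraints rest on it. -/
theorem exists_mem_entropyHull_of_message [Nonempty M] (hn : 0 < n)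
    (hW : ∀ x, W x ∈ stdSimplex ℝ (Y × Z)) (enc : M → Fin n → X) (w : M → A) :
    ∃ α β : ℝ, (inputType W enc, α, β) ∈ entropyHull (leftChannel W) (rightChannel W) ∧
      n * α ≤ entropy (blockLaw W enc) (fun ω => (w ω.1, fun i => (ω.2 i).1))
        - entropy (blockLaw W enc) (fun ω => w ω.1) ∧
      n * β ≤ entropy (blockLaw W enc) (fun ω => (w ω.1, fun i => (ω.2 i).2))
        - entropy (blockLaw W enc) (fun ω => w ω.1) ∧
      n * (β - α) = entropy (blockLaw W enc) (fun ω => (w ω.1, fun i => (ω.2 i).2))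
        - entropy (blockLaw W enc) (fun ω => (w ω.1, fun i => (ω.2 i).1)) := by
  set P := blockLaw W enc with hP
  have hPs : P ∈ stdSimplex ℝ _ := blockLaw_mem_stdSimplex hW enc
  have hn' : (n : ℝ) ≠ 0 := by positivity
  let wr : M × (Fin n → Y × Z) → A := fun ω => w ω.1
  let y : M × (Fin n → Y × Z) → Fin n → Y := fun ω i => (ω.2 i).1
  let z : M × (Fin n → Y × Z) → Fin n → Z := fun ω i => (ω.2 i).2
  let a : Fin n → ℝ := fun i =>
    entropy P (fun ω => (pastFuture wr y z i ω, y ω i)) - entropy P (pastFuture wr y z i)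
  let b : Fin n → ℝ := fun i =>
    entropy P (fun ω => (pastFuture wr y z i ω, z ω i)) - entropy P (pastFuture wr y z i)
  refine ⟨∑ i, (1 / n : ℝ) * a i, ∑ i, (1 / n : ℝ) * b i, ?_, ?_, ?_, ?_⟩
  · have hmem : ∀ i, (law P (fun ω => enc ω.1 i), a i, b i)
        ∈ entropyHull (leftChannel W) (rightChannel W) := fun i =>
      condEntropy_mem_entropyHull hPs (pastFuture wr y z i) (fun ω => enc ω.1 i)
        (fun ω => y ω i) (fun ω => z ω i) (leftChannel_mem_stdSimplex hW)
        (rightChannel_mem_stdSimplex hW)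
        (law_memoryless_left hW enc i (pastFuture_forget w i))
        (law_memoryless_right hW enc i (pastFuture_forget w i))
    have hu := uniform_mem_stdSimplex hn
    have : ∑ i, (1 / n : ℝ) • (law P (fun ω => enc ω.1 i), a i, b i)
        ∈ entropyHull (leftChannel W) (rightChannel W) :=
      (convex_convexHull ℝ _).sum_mem (t := Finset.univ) (fun i _ => hu.1 i) hu.2
        fun i _ => hmem i
    convert this using 1
    simp only [Prod.ext_iff, Prod.fst_sum, Prod.snd_sum, Prod.smul_mk, smul_eq_mul, and_self,
      inputType, hP]
  · rw [← Finset.mul_sum, ← mul_assoc, mul_one_div_cancel hn', one_mul]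
    exact sum_condEntropy_past_le hPs.1 wr y z
  · rw [← Finset.mul_sum, ← mul_assoc, mul_one_div_cancel hn', one_mul]
    exact sum_condEntropy_future_le hPs.1 wr y z
  · rw [← Finset.mul_sum, ← Finset.mul_sum, ← mul_sub, ← mul_assoc, mul_one_div_cancel hn',
      one_mul, ← Finset.sum_sub_distrib]
    refine Eq.trans ?_ (entropy_sub_entropy_eq_sum P wr y z).symm
    exact Finset.sum_congr rfl fun i _ => sub_sub_sub_cancel_right _ _ _

theorem sum_outputEntropy_law_le [Nonempty M] (hn : 0 < n) {B : Type*} [Fintype B] {K : X → B → ℝ}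
    (hK : ∀ x, K x ∈ stdSimplex ℝ B)
    (hW : ∀ x, W x ∈ stdSimplex ℝ (Y × Z)) (enc : M → Fin n → X) :
    ∑ i, outputEntropy K (law (blockLaw W enc) fun ω => enc ω.1 i)
      ≤ n * outputEntropy K (inputType W enc) := by
  have h := sum_outputEntropy_le hK (uniform_mem_stdSimplex hn)
    (p := fun i => law (blockLaw W enc) fun ω => enc ω.1 i)
    fun i => law_mem_stdSimplex (blockLaw_mem_stdSimplex hW enc) _
  rw [← Finset.mul_sum] at h
  have hn' : (n : ℝ) ≠ 0 := by positivity
  calc _ = n * (1 / n * ∑ i, outputEntropy K (law (blockLaw W enc) fun ω => enc ω.1 i)) := by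
        field_simp
    _ ≤ _ := mul_le_mul_of_nonneg_left h (Nat.cast_nonneg n)

theorem entropy_left_output_le [Nonempty M] (hn : 0 < n) (hW : ∀ x, W x ∈ stdSimplex ℝ (Y × Z))
    (enc : M → Fin n → X) :
    entropy (blockLaw W enc) (fun ω i => (ω.2 i).1)
      ≤ n * outputEntropy (leftChannel W) (inputType W enc) := by
  refine (entropy_le_sum_entropy (blockLaw_mem_stdSimplex hW enc) _).trans
    (le_trans (le_of_eq ?_)
      (sum_outputEntropy_law_le hn (leftChannel_mem_stdSimplex hW) hW enc))
  exact Finset.sum_congr rfl fun i _ => entropy_of_law fun t => by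
    have h := law_memoryless_left hW enc i (a := fun _ => ()) (fun _ _ _ _ => rfl) () t
    simpa only [law_unit_pair] using h

theorem entropy_right_output_le [Nonempty M] (hn : 0 < n) (hW : ∀ x, W x ∈ stdSimplex ℝ (Y × Z))
    (enc : M → Fin n → X) :
    entropy (blockLaw W enc) (fun ω i => (ω.2 i).2)
      ≤ n * outputEntropy (rightChannel W) (inputType W enc) := by
  refine (entropy_le_sum_entropy (blockLaw_mem_stdSimplex hW enc) _).trans
    (le_trans (le_of_eq ?_)
      (sum_outputEntropy_law_le hn (rightChannel_mem_stdSimplex hW) hW enc))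
  exact Finset.sum_congr rfl fun i _ => entropy_of_law fun t => by
    have h := law_memoryless_right hW enc i (a := fun _ => ()) (fun _ _ _ _ => rfl) () t
    simpa only [law_unit_pair] using h

/-- The largest violation, by the rate pair `(R₁, R₂)`, of the four constraints of the outer bound
for two points `k`, `l` of the entropy hull with the same input pmf. -/
def rateExcess (K : X → Y → ℝ) (L : X → Z → ℝ) (R₁ R₂ : ℝ)
    (k : ((X → ℝ) × ℝ × ℝ) × ((X → ℝ) × ℝ × ℝ)) : ℝ :=
  max (max (R₁ - (outputEntropy K k.1.1 - k.1.2.1)) (R₂ - (outputEntropy L k.1.1 - k.2.2.2)))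
    (max (R₁ + R₂ - (outputEntropy K k.1.1 - k.1.2.1 + k.1.2.2 - noiseEntropy L k.1.1))
      (R₁ + R₂ - (outputEntropy L k.1.1 - k.2.2.2 + k.2.2.1 - noiseEntropy K k.1.1)))

theorem rateExcess_le_iff {K : X → Y → ℝ} {L : X → Z → ℝ} {R₁ R₂ ε : ℝ}
    {k : ((X → ℝ) × ℝ × ℝ) × ((X → ℝ) × ℝ × ℝ)} :
    rateExcess K L R₁ R₂ k ≤ ε ↔
      R₁ - ε ≤ outputEntropy K k.1.1 - k.1.2.1 ∧ R₂ - ε ≤ outputEntropy L k.1.1 - k.2.2.2 ∧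
      R₁ + R₂ - ε ≤ outputEntropy K k.1.1 - k.1.2.1 + k.1.2.2 - noiseEntropy L k.1.1 ∧
      R₁ + R₂ - ε ≤ outputEntropy L k.1.1 - k.2.2.2 + k.2.2.1 - noiseEntropy K k.1.1 := by
  simp only [rateExcess, max_le_iff, sub_le_comm (b := ε), and_assoc]

theorem continuous_rateExcess (K : X → Y → ℝ) (L : X → Z → ℝ) (R₁ R₂ : ℝ) :
    Continuous (rateExcess K L R₁ R₂) := by
  have h1 := continuous_outputEntropy K
  have h2 := continuous_outputEntropy L
  have h3 := continuous_noiseEntropy K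
  have h4 := continuous_noiseEntropy L
  unfold rateExcess
  fun_prop

/-- Pairs of points of the entropy hull with the same input pmf. -/
def hullPairs (K : X → Y → ℝ) (L : X → Z → ℝ) : Set (((X → ℝ) × ℝ × ℝ) × ((X → ℝ) × ℝ × ℝ)) :=
  {k | k.1 ∈ entropyHull K L ∧ k.2 ∈ entropyHull K L ∧ k.1.1 = k.2.1}

theorem isCompact_hullPairs (K : X → Y → ℝ) (L : X → Z → ℝ) : IsCompact (hullPairs K L) := by
  have h : hullPairs K L = (entropyHull K L ×ˢ entropyHull K L) ∩ {k | k.1.1 = k.2.1} := by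
    ext k; simp [hullPairs, and_assoc]
  rw [h]
  exact ((isCompact_entropyHull K L).prod (isCompact_entropyHull K L)).inter_right
    (isClosed_eq (by fun_prop) (by fun_prop))

/-- The outer bound is closed: constraints met up to every positive error are met exactly. -/
theorem exists_hullPairs_of_forall_pos {K : X → Y → ℝ} {L : X → Z → ℝ} {R₁ R₂ : ℝ}
    (h : ∀ ε > 0, ∃ k ∈ hullPairs K L, rateExcess K L R₁ R₂ k ≤ ε) :
    ∃ k ∈ hullPairs K L, rateExcess K L R₁ R₂ k ≤ 0 := by
  obtain ⟨k₀, hk₀, -⟩ := h 1 one_pos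
  -- A minimiser of the excess exists by compactness, and its excess is at most every positive `ε`.
  obtain ⟨k, hk, hmin⟩ := (isCompact_hullPairs K L).exists_isMinOn ⟨k₀, hk₀⟩
    (continuous_rateExcess K L R₁ R₂).continuousOn
  refine ⟨k, hk, le_of_forall_pos_le_add fun ε hε => ?_⟩
  obtain ⟨k', hk', hle⟩ := h ε hε
  rw [zero_add]
  exact (hmin hk').trans hle

/-- The converse for a block code with independent messages `w₁`, `w₂`, before the limit. -/
theorem exists_hullPairs_of_block [Nonempty M] {A₁ A₂ : Type*} [Fintype A₁] [DecidableEq A₁]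
    [Nonempty A₁] [Fintype A₂] [DecidableEq A₂] [Nonempty A₂] (hn : 0 < n)
    (hW : ∀ x, W x ∈ stdSimplex ℝ (Y × Z)) (enc : M → Fin n → X) (w₁ : M → A₁) (w₂ : M → A₂)
    (h₁ : ∀ s, law (blockLaw W enc) (fun ω => w₁ ω.1) s = 1 / Fintype.card A₁)
    (h₂ : ∀ s, law (blockLaw W enc) (fun ω => w₂ ω.1) s = 1 / Fintype.card A₂)
    (h₁₂ : ∀ s, law (blockLaw W enc) (fun ω => (w₁ ω.1, w₂ ω.1)) s
      = 1 / (Fintype.card A₁ * Fintype.card A₂))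
    (g₁ : (Fin n → Y) → Option A₁) (g₂ : (Fin n → Z) → Option A₂) {Pe : ℝ}
    (hg₁ : ∑ ω, (if g₁ (fun i => (ω.2 i).1) ≠ some (w₁ ω.1) then blockLaw W enc ω else 0) ≤ Pe)
    (hg₂ : ∑ ω, (if g₂ (fun i => (ω.2 i).2) ≠ some (w₂ ω.1) then blockLaw W enc ω else 0) ≤ Pe) :
    ∃ k ∈ hullPairs (leftChannel W) (rightChannel W),
      rateExcess (leftChannel W) (rightChannel W)
        (((1 - Pe) * Real.logb 2 (Fintype.card A₁) - 1) / n)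
        (((1 - Pe) * Real.logb 2 (Fintype.card A₂) - 1) / n) k ≤ 0 := by
  have hPs : blockLaw W enc ∈ stdSimplex ℝ _ := blockLaw_mem_stdSimplex hW enc
  obtain ⟨α, β, hαβ, hα, -, hd⟩ := exists_mem_entropyHull_of_message hn hW enc w₁
  obtain ⟨γ, δ, hγδ, -, hδ, hd'⟩ := exists_mem_entropyHull_of_message hn hW enc w₂
  -- This third point only serves to bound the block output entropies given both messages from below
  -- by noise entropies.
  obtain ⟨μ, ν, hμν, hμ, hν, -⟩ := exists_mem_entropyHull_of_message hn hW enc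
    fun m => (w₁ m, w₂ m)
  obtain ⟨hμ', hν'⟩ := noiseEntropy_le_of_mem_entropyHull (leftChannel_mem_stdSimplex hW)
    (rightChannel_mem_stdSimplex hW) hμν
  have hY := entropy_left_output_le hn hW enc
  have hZ := entropy_right_output_le hn hW enc
  have c₁ : (0 : ℝ) < Fintype.card A₁ := by exact_mod_cast Fintype.card_pos
  have c₂ : (0 : ℝ) < Fintype.card A₂ := by exact_mod_cast Fintype.card_pos
  have e₁ := entropy_of_uniform hPs.2 h₁
  have e₂ := entropy_of_uniform hPs.2 h₂
  have e₁₂ := entropy_of_uniform hPs.2 h₁₂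
  rw [Real.logb_mul c₁.ne' c₂.ne'] at e₁₂
  have l₁ : 0 ≤ Real.logb 2 (Fintype.card A₁) :=
    Real.logb_nonneg one_lt_two (by exact_mod_cast Fintype.card_pos)
  have l₂ : 0 ≤ Real.logb 2 (Fintype.card A₂) :=
    Real.logb_nonneg one_lt_two (by exact_mod_cast Fintype.card_pos)
  have f₁ := fano hPs (fun ω => w₁ ω.1) (fun ω i => (ω.2 i).1) g₁
  have f₂ := fano hPs (fun ω => w₂ ω.1) (fun ω i => (ω.2 i).2) g₂
  have f₁' := mul_le_mul_of_nonneg_right hg₁ l₁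
  have f₂' := mul_le_mul_of_nonneg_right hg₂ l₂
  -- Submodularity gives $H(W_2|Z^n)\ge H(W_2|W_1Z^n)$. As the messages are independent,
  -- $I(W_2;Z^n)\le I(W_2;Z^n|W_1)$, the source of one sum-rate constraint; `sY` gives the other.
  have sZ := entropy_submodular hPs.1 (fun ω => w₁ ω.1) (fun ω => w₂ ω.1) fun ω i => (ω.2 i).2
  have sY := entropy_submodular hPs.1 (fun ω => w₁ ω.1) (fun ω => w₂ ω.1) fun ω i => (ω.2 i).1
  have tZ : entropy (blockLaw W enc) (fun ω => (w₁ ω.1, w₂ ω.1, fun i => (ω.2 i).2))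
      = entropy (blockLaw W enc) (fun ω => ((w₁ ω.1, w₂ ω.1), fun i => (ω.2 i).2)) :=
    entropy_congr _ fun ω ω' => by simp only [Prod.mk.injEq, and_assoc]
  have tY : entropy (blockLaw W enc) (fun ω => (w₁ ω.1, w₂ ω.1, fun i => (ω.2 i).1))
      = entropy (blockLaw W enc) (fun ω => ((w₁ ω.1, w₂ ω.1), fun i => (ω.2 i).1)) :=
    entropy_congr _ fun ω ω' => by simp only [Prod.mk.injEq, and_assoc]
  have hn' : (0 : ℝ) < n := by exact_mod_cast hn
  have m₁ := mul_le_mul_of_nonneg_left hμ' hn'.le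
  have m₂ := mul_le_mul_of_nonneg_left hν' hn'.le
  refine ⟨((inputType W enc, α, β), (inputType W enc, γ, δ)), ⟨hαβ, hγδ, rfl⟩, ?_⟩
  rw [rateExcess_le_iff]
  simp only [sub_zero, ← add_div, div_le_iff₀ hn']
  refine ⟨?_, ?_, ?_, ?_⟩ <;> linarith

end SingleLetter

/-! ### The Nair–El Gamal region in terms of output entropies -/

section Region

variable {Q U V X Y Z A : Type*} [Fintype Q] [DecidableEq Q] [Fintype U] [DecidableEq U]
  [Fintype V] [DecidableEq V] [Fintype X] [DecidableEq X] [Fintype Y] [DecidableEq Y]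
  [Fintype Z] [DecidableEq Z] [Fintype A] [DecidableEq A]

theorem law_jointLaw_left (p : Q × U × V × X → ℝ) (W : X → Y × Z → ℝ) (a : Q × U × V → A)
    (s : A) (t : Y) :
    law (jointLaw p W) (fun ω => (a (ω.1, ω.2.1, ω.2.2.1), ω.2.2.2.2.1)) (s, t)
      = ∑ x, (∑ q, ∑ u, ∑ v, if a (q, u, v) = s then p (q, u, v, x) else 0)
        * leftChannel W x t := by
  simp only [law_eq_sum_ite, Fintype.sum_prod_type, jointLaw, Prod.mk.injEq, Finset.sum_mul]
  conv_rhs => rw [Finset.sum_comm]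
  refine Finset.sum_congr rfl fun q _ => ?_
  conv_rhs => rw [Finset.sum_comm]
  refine Finset.sum_congr rfl fun u _ => ?_
  conv_rhs => rw [Finset.sum_comm]
  refine Finset.sum_congr rfl fun v _ => Finset.sum_congr rfl fun x _ => ?_
  by_cases ha : a (q, u, v) = s <;> simp [ha, leftChannel, Finset.mul_sum]

theorem law_jointLaw_right (p : Q × U × V × X → ℝ) (W : X → Y × Z → ℝ) (a : Q × U × V → A)
    (s : A) (t : Z) :
    law (jointLaw p W) (fun ω => (a (ω.1, ω.2.1, ω.2.2.1), ω.2.2.2.2.2)) (s, t)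
      = ∑ x, (∑ q, ∑ u, ∑ v, if a (q, u, v) = s then p (q, u, v, x) else 0)
        * rightChannel W x t := by
  simp only [law_eq_sum_ite, Fintype.sum_prod_type, jointLaw, Prod.mk.injEq, Finset.sum_mul]
  conv_rhs => rw [Finset.sum_comm]
  refine Finset.sum_congr rfl fun q _ => ?_
  conv_rhs => rw [Finset.sum_comm]
  refine Finset.sum_congr rfl fun u _ => ?_
  conv_rhs => rw [Finset.sum_comm]
  refine Finset.sum_congr rfl fun v _ => Finset.sum_congr rfl fun x _ => ?_
  by_cases ha : a (q, u, v) = s <;> simp [ha, rightChannel, Finset.mul_sum]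

/-- The Nair–El Gamal constraints in terms of output entropies. -/
theorem mem_negRegion_of_le {W : X → Y × Z → ℝ} {p : Q × U × V × X → ℝ} {R₁ R₂ : ℝ}
    {hY hZ yU zU yV zV yX zX : ℝ}
    (eY : entropy (jointLaw p W) (fun ω => ω.2.2.2.2.1) = hY)
    (eZ : entropy (jointLaw p W) (fun ω => ω.2.2.2.2.2) = hZ)
    (eyU : entropy (jointLaw p W) (fun ω => ((ω.1, ω.2.1), ω.2.2.2.2.1))
      - entropy (jointLaw p W) (fun ω => (ω.1, ω.2.1)) = yU)
    (ezU : entropy (jointLaw p W) (fun ω => ((ω.1, ω.2.1), ω.2.2.2.2.2))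
      - entropy (jointLaw p W) (fun ω => (ω.1, ω.2.1)) = zU)
    (eyV : entropy (jointLaw p W) (fun ω => ((ω.1, ω.2.2.1), ω.2.2.2.2.1))
      - entropy (jointLaw p W) (fun ω => (ω.1, ω.2.2.1)) = yV)
    (ezV : entropy (jointLaw p W) (fun ω => ((ω.1, ω.2.2.1), ω.2.2.2.2.2))
      - entropy (jointLaw p W) (fun ω => (ω.1, ω.2.2.1)) = zV)
    (eyX : entropy (jointLaw p W) (fun ω => ((ω.1, ω.2.1, ω.2.2.1), ω.2.2.2.2.1))
      - entropy (jointLaw p W) (fun ω => (ω.1, ω.2.1, ω.2.2.1)) = yX)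
    (ezX : entropy (jointLaw p W) (fun ω => ((ω.1, ω.2.1, ω.2.2.1), ω.2.2.2.2.2))
      - entropy (jointLaw p W) (fun ω => (ω.1, ω.2.1, ω.2.2.1)) = zX)
    (h₁ : R₁ ≤ hY - yU) (h₂ : R₂ ≤ hZ - zV) (h₃ : R₁ + R₂ ≤ yV - yX + (hZ - zV))
    (h₄ : R₁ + R₂ ≤ hY - yU + (zU - zX)) :
    (R₁, R₂) ∈ negRegion W p := by
  have i₁ : entropy (jointLaw p W) (fun ω => (ω.2.1, ω.1, ω.2.2.1))
      = entropy (jointLaw p W) (fun ω => (ω.1, ω.2.1, ω.2.2.1)) :=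
    entropy_congr _ fun ω ω' => by simp only [Prod.mk.injEq]; tauto
  have i₂ : entropy (jointLaw p W) (fun ω => (ω.2.2.1, ω.1, ω.2.1))
      = entropy (jointLaw p W) (fun ω => (ω.1, ω.2.1, ω.2.2.1)) :=
    entropy_congr _ fun ω ω' => by simp only [Prod.mk.injEq]; tauto
  have i₃ : entropy (jointLaw p W) (fun ω => (ω.2.1, ω.2.2.2.2.1, ω.1, ω.2.2.1))
      = entropy (jointLaw p W) (fun ω => ((ω.1, ω.2.1, ω.2.2.1), ω.2.2.2.2.1)) :=
    entropy_congr _ fun ω ω' => by simp only [Prod.mk.injEq]; tauto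
  have i₄ : entropy (jointLaw p W) (fun ω => (ω.2.2.1, ω.2.2.2.2.2, ω.1, ω.2.1))
      = entropy (jointLaw p W) (fun ω => ((ω.1, ω.2.1, ω.2.2.1), ω.2.2.2.2.2)) :=
    entropy_congr _ fun ω ω' => by simp only [Prod.mk.injEq]; tauto
  have i₅ : entropy (jointLaw p W) (fun ω => (ω.2.2.2.2.1, ω.1, ω.2.2.1))
      = entropy (jointLaw p W) (fun ω => ((ω.1, ω.2.2.1), ω.2.2.2.2.1)) :=
    entropy_congr _ fun ω ω' => by simp only [Prod.mk.injEq]; tauto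
  have i₆ : entropy (jointLaw p W) (fun ω => (ω.2.2.2.2.2, ω.1, ω.2.1))
      = entropy (jointLaw p W) (fun ω => ((ω.1, ω.2.1), ω.2.2.2.2.2)) :=
    entropy_congr _ fun ω ω' => by simp only [Prod.mk.injEq]; tauto
  simp only [negRegion, mutualInfo, condMutualInfo, condEntropy, Set.mem_ofPred_eq]
  refine ⟨?_, ?_, ?_, ?_⟩ <;> linarith

end Region

/-! ### Realising two mixtures by a one-time pad -/

section OneTimePad

variable {G Q U V X Y Z : Type*} [AddCommGroup G] [Fintype G] [DecidableEq G]
  [Fintype Q] [DecidableEq Q] [Fintype U] [DecidableEq U]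
  [Fintype V] [DecidableEq V] [Fintype X] [DecidableEq X] [Fintype Y] [DecidableEq Y]
  [Fintype Z] [DecidableEq Z]

/-- The conditional pmf of `(Q, X)` given the keys `U = (k₁, k₂)` and `V = (l₁, l₂)`: a triple
`(s, t, x)` of law `π` is encrypted as `Q = (s + k₁, t + l₁, e x + k₂ + l₂)`. -/
def padKernel (eQ : Q ≃ G × G × G) (eU : U ≃ G × G) (eV : V ≃ G × G) (e : X → G)
    (π : G → G → X → ℝ) (u : U) (v : V) (s : Q × X) : ℝ :=
  if (eQ s.1).2.2 = e s.2 + (eU u).2 + (eV v).2 then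
    π ((eQ s.1).1 - (eU u).1) ((eQ s.1).2.1 - (eV v).1) s.2 else 0

variable (eQ : Q ≃ G × G × G) (eU : U ≃ G × G) (eV : V ≃ G × G) (e : X → G)
  (π : G → G → X → ℝ)

theorem sum_sub_eq_sum (c : G) (f : G → ℝ) : ∑ g, f (c - g) = ∑ g, f g :=
  (Equiv.subLeft c).sum_comp f

theorem sum_sub_eq_sum' (c : G) (f : G → ℝ) : ∑ g, f (g - c) = ∑ g, f g :=
  (Equiv.subRight c).sum_comp f

/-- For each $l_1$ exactly one $l_2$ fits the third coordinate of `q`, and as $l_1$ varies the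
second coordinate decrypts to every `t` once. Without `V`, those two coordinates therefore reveal
nothing. -/
theorem sum_padKernel_right (u : U) (q : Q) (x : X) :
    ∑ v, padKernel eQ eU eV e π u v (q, x) = ∑ t, π ((eQ q).1 - (eU u).1) t x := by
  rw [← eV.symm.sum_comp, Fintype.sum_prod_type]
  simp only [padKernel, Equiv.apply_symm_apply, ← sub_eq_iff_eq_add']
  simp only [Finset.sum_ite_eq, Finset.mem_univ, if_true]
  exact sum_sub_eq_sum _ fun t => π ((eQ q).1 - (eU u).1) t x

theorem sum_padKernel_left (v : V) (q : Q) (x : X) :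
    ∑ u, padKernel eQ eU eV e π u v (q, x) = ∑ s, π s ((eQ q).2.1 - (eV v).1) x := by
  rw [← eU.symm.sum_comp, Fintype.sum_prod_type]
  have hk : ∀ k l : G, (eQ q).2.2 = e x + k + l ↔ (eQ q).2.2 - l - e x = k := fun k l => by
    rw [sub_eq_iff_eq_add', sub_eq_iff_eq_add]
  simp only [padKernel, Equiv.apply_symm_apply, hk]
  simp only [Finset.sum_ite_eq, Finset.mem_univ, if_true]
  exact sum_sub_eq_sum _ fun s => π s ((eQ q).2.1 - (eV v).1) x

theorem sum_padKernel_aux (u : U) (v : V) (x : X) :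
    ∑ q, padKernel eQ eU eV e π u v (q, x) = ∑ s, ∑ t, π s t x := by
  rw [← eQ.symm.sum_comp]
  simp only [Fintype.sum_prod_type, padKernel, Equiv.apply_symm_apply, Finset.sum_ite_eq',
    Finset.mem_univ, if_true]
  rw [sum_sub_eq_sum' _ fun s => ∑ t, π s (t - (eV v).1) x]
  exact Finset.sum_congr rfl fun s _ => sum_sub_eq_sum' _ fun t => π s t x

theorem padKernel_mem_stdSimplex (hπ : ∀ s t x, 0 ≤ π s t x) (h1 : ∑ x, ∑ s, ∑ t, π s t x = 1)
    (u : U) (v : V) : padKernel eQ eU eV e π u v ∈ stdSimplex ℝ (Q × X) := by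
  refine ⟨fun s => ?_, ?_⟩
  · unfold padKernel
    split_ifs
    · exact hπ _ _ _
    · exact le_rfl
  · rw [Fintype.sum_prod_type_right]
    simp only [sum_padKernel_aux, h1]

theorem inputDeterministic_padKernel [Nonempty X] (he : Function.Injective e) :
    InputDeterministic (padKernel eQ eU eV e π) := by
  refine ⟨fun s => Function.invFun e ((eQ s.1).2.2 - (eU s.2.1).2 - (eV s.2.2).2),
    fun u v q x h => ?_⟩
  have h' : (eQ q).2.2 = e x + (eU u).2 + (eV v).2 := by
    by_contra hne
    exact h (if_neg hne)
  have : (eQ q).2.2 - (eU u).2 - (eV v).2 = e x := by rw [h']; abel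
  simp only [this]
  exact (Function.leftInverse_invFun he x).symm

/-- A law of `(S, T, X)` with prescribed marginals of `(S, X)` and `(T, X)` that agree on `X`. -/
def coupling (w v : G → ℝ) (q r : G → X → ℝ) (p : X → ℝ) (s t : G) (x : X) : ℝ :=
  w s * q s x * (v t * r t x) / p x

variable {w v : G → ℝ} {q r : G → X → ℝ} {p : X → ℝ}

theorem coupling_nonneg (hw : w ∈ stdSimplex ℝ G) (hv : v ∈ stdSimplex ℝ G)
    (hq : ∀ s, q s ∈ stdSimplex ℝ X) (hr : ∀ t, r t ∈ stdSimplex ℝ X)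
    (hp : p ∈ stdSimplex ℝ X) (s t : G) (x : X) : 0 ≤ coupling w v q r p s t x :=
  div_nonneg (mul_nonneg (mul_nonneg (hw.1 s) ((hq s).1 x)) (mul_nonneg (hv.1 t) ((hr t).1 x)))
    (hp.1 x)

theorem mul_eq_zero_of_sum_smul (hw : w ∈ stdSimplex ℝ G) (hq : ∀ s, q s ∈ stdSimplex ℝ X)
    (h : ∑ s, w s • q s = p) {x : X} (hx : p x = 0) (s : G) : w s * q s x = 0 := by
  rw [← h, Finset.sum_apply] at hx
  exact (Finset.sum_eq_zero_iff_of_nonneg fun s _ => mul_nonneg (hw.1 s) ((hq s).1 x)).1 hx s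
    (Finset.mem_univ s)

/-- The coupling makes $S$ and $T$ conditionally independent given $X$. Where `p x = 0` the quotient
is 0 by convention, as it should be: `w s * q s x` is one of the nonnegative terms summing to `p x`.
-/
theorem sum_coupling_right (hw : w ∈ stdSimplex ℝ G) (hq : ∀ s, q s ∈ stdSimplex ℝ X)
    (h : ∑ s, w s • q s = p) (h' : ∑ t, v t • r t = p) (s : G) (x : X) :
    ∑ t, coupling w v q r p s t x = w s * q s x := by
  have hs : ∑ t, v t * r t x = p x := by rw [← h', Finset.sum_apply]; rfl
  simp only [coupling]
  rw [← Finset.sum_div, ← Finset.mul_sum, hs]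
  by_cases hx : p x = 0
  · rw [mul_eq_zero_of_sum_smul hw hq h hx]; simp
  · field_simp

theorem sum_coupling_left (hv : v ∈ stdSimplex ℝ G) (hr : ∀ t, r t ∈ stdSimplex ℝ X)
    (h : ∑ s, w s • q s = p) (h' : ∑ t, v t • r t = p) (t : G) (x : X) :
    ∑ s, coupling w v q r p s t x = v t * r t x := by
  rw [← sum_coupling_right hv hr h' h t x]
  simp only [coupling, mul_comm]

/-- The pair `(q, u)` has five coordinates in `G`; prescribing one difference leaves four of them
free. -/
theorem sum_pair_sub (f : G → ℝ) :
    ∑ q : Q, ∑ u : U, f ((eQ q).1 - (eU u).1) = (Fintype.card G : ℝ) ^ 4 * ∑ g, f g := by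
  rw [← eQ.symm.sum_comp]
  simp only [← eU.symm.sum_comp, Equiv.apply_symm_apply, Fintype.sum_prod_type, Finset.sum_const,
    Finset.card_univ, nsmul_eq_mul, ← Finset.mul_sum, sum_sub_eq_sum, Fintype.card_prod,
    Nat.cast_mul]
  ring

theorem sum_pair_sub' (f : G → ℝ) :
    ∑ q : Q, ∑ v : V, f ((eQ q).2.1 - (eV v).1) = (Fintype.card G : ℝ) ^ 4 * ∑ g, f g := by
  rw [← eQ.symm.sum_comp]
  simp only [← eV.symm.sum_comp, Equiv.apply_symm_apply, Fintype.sum_prod_type, Finset.sum_const,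
    Finset.card_univ, nsmul_eq_mul, ← Finset.mul_sum, sum_sub_eq_sum, Fintype.card_prod,
    Nat.cast_mul]
  ring

/-- Encrypting two mixtures of the same input pmf with independent uniform keys realises their
rate constraints in the Nair–El Gamal region. -/
theorem mem_negRegion_padKernel [Nonempty X] {W : X → Y × Z → ℝ}
    (hW : ∀ x, W x ∈ stdSimplex ℝ (Y × Z)) (he : Function.Injective e)
    (hw : w ∈ stdSimplex ℝ G) (hv : v ∈ stdSimplex ℝ G)
    (hq : ∀ s, q s ∈ stdSimplex ℝ X) (hr : ∀ t, r t ∈ stdSimplex ℝ X)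
    (h : ∑ s, w s • q s = p) (h' : ∑ t, v t • r t = p) {R₁ R₂ : ℝ}
    (hR : rateExcess (leftChannel W) (rightChannel W) R₁ R₂
      ((p, ∑ s, w s * outputEntropy (leftChannel W) (q s),
          ∑ s, w s * outputEntropy (rightChannel W) (q s)),
        (p, ∑ t, v t * outputEntropy (leftChannel W) (r t),
          ∑ t, v t * outputEntropy (rightChannel W) (r t))) ≤ 0) :
    (R₁, R₂) ∈ negRegion W (inputLaw (fun _ => 1 / (Fintype.card G : ℝ) ^ 2)
      (fun _ => 1 / (Fintype.card G : ℝ) ^ 2) (padKernel eQ eU eV e (coupling w v q r p))) := by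
  set c : ℝ := (Fintype.card G : ℝ) with hc
  have hc0 : c ≠ 0 := by
    rw [hc]
    exact_mod_cast Fintype.card_ne_zero
  set π := coupling w v q r p with hπ
  set P := inputLaw (fun _ : U => 1 / c ^ 2) (fun _ : V => 1 / c ^ 2) (padKernel eQ eU eV e π)
    with hP
  have hPv : ∀ q' u v' x, P (q', u, v', x) = 1 / c ^ 4 * padKernel eQ eU eV e π u v' (q', x) := by
    intro q' u v' x
    rw [hP, inputLaw]
    ring
  have mU : ∀ q' u x, ∑ v', P (q', u, v', x)
      = 1 / c ^ 4 * w ((eQ q').1 - (eU u).1) * q ((eQ q').1 - (eU u).1) x := by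
    intro q' u x
    simp only [hPv]
    rw [← Finset.mul_sum, sum_padKernel_right, hπ, sum_coupling_right hw hq h h', mul_assoc]
  have mV : ∀ q' v' x, ∑ u, P (q', u, v', x)
      = 1 / c ^ 4 * v ((eQ q').2.1 - (eV v').1) * r ((eQ q').2.1 - (eV v').1) x := by
    intro q' v' x
    simp only [hPv]
    rw [← Finset.mul_sum, sum_padKernel_left, hπ, sum_coupling_left hv hr h h', mul_assoc]
  have mX : ∀ x, ∑ q', ∑ u, ∑ v', P (q', u, v', x) = p x := by
    intro x
    simp only [mU, mul_assoc, ← Finset.mul_sum]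
    rw [sum_pair_sub eQ eU fun g => w g * q g x, ← h, Finset.sum_apply, ← hc]
    simp only [Pi.smul_apply, smul_eq_mul]
    field_simp
  have hL := leftChannel_mem_stdSimplex hW
  have hZ := rightChannel_mem_stdSimplex hW
  have iU : ∀ q' u x, (∑ q₁, ∑ u₁, ∑ v₁, if (q₁, u₁) = (q', u) then P (q₁, u₁, v₁, x) else 0)
      = 1 / c ^ 4 * w ((eQ q').1 - (eU u).1) * q ((eQ q').1 - (eU u).1) x := by
    intro q' u x
    rw [← mU]
    simp [ite_and, Finset.sum_ite_irrel]
  have iV : ∀ q' v' x, (∑ q₁, ∑ u₁, ∑ v₁, if (q₁, v₁) = (q', v') then P (q₁, u₁, v₁, x) else 0)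
      = 1 / c ^ 4 * v ((eQ q').2.1 - (eV v').1) * r ((eQ q').2.1 - (eV v').1) x := by
    intro q' v' x
    rw [← mV]
    simp [ite_and, Finset.sum_ite_irrel]
  have iX : ∀ s x, (∑ q₁, ∑ u₁, ∑ v₁, if (q₁, u₁, v₁) = s then P (q₁, u₁, v₁, x) else 0)
      = P (s.1, s.2.1, s.2.2, x) := by
    rintro ⟨q', u, v'⟩ x
    simp [ite_and, Finset.sum_ite_irrel]
  let f : Q × U × V → X := fun s =>
    Function.invFun e ((eQ s.1).2.2 - (eU s.2.1).2 - (eV s.2.2).2)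
  have hf : ∀ s x, P (s.1, s.2.1, s.2.2, x) ≠ 0 → x = f s := by
    intro s x hne
    rw [hPv] at hne
    have h' : (eQ s.1).2.2 = e x + (eU s.2.1).2 + (eV s.2.2).2 := by
      by_contra hne'
      exact hne (by rw [padKernel, if_neg hne', mul_zero])
    have h'' : (eQ s.1).2.2 - (eU s.2.1).2 - (eV s.2.2).2 = e x := by rw [h']; abel
    simp only [f, h'']
    exact (Function.leftInverse_invFun he x).symm
  have sU : ∀ F : (X → ℝ) → ℝ, ∑ s : Q × U, 1 / c ^ 4 * w ((eQ s.1).1 - (eU s.2).1)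
      * F (q ((eQ s.1).1 - (eU s.2).1)) = ∑ g, w g * F (q g) := by
    intro F
    simp only [Fintype.sum_prod_type, mul_assoc, ← Finset.mul_sum]
    rw [sum_pair_sub eQ eU fun g => w g * F (q g), ← hc]
    field_simp
  have sV : ∀ F : (X → ℝ) → ℝ, ∑ s : Q × V, 1 / c ^ 4 * v ((eQ s.1).2.1 - (eV s.2).1)
      * F (r ((eQ s.1).2.1 - (eV s.2).1)) = ∑ g, v g * F (r g) := by
    intro F
    simp only [Fintype.sum_prod_type, mul_assoc, ← Finset.mul_sum]
    rw [sum_pair_sub' eQ eV fun g => v g * F (r g), ← hc]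
    field_simp
  have kX : ∀ (s : Q × U × V) (F : X → ℝ), ∑ x, P (s.1, s.2.1, s.2.2, x) * F x
      = (∑ x, P (s.1, s.2.1, s.2.2, x)) * F (f s) := by
    intro s F
    rw [Finset.sum_mul]
    refine Finset.sum_congr rfl fun x _ => ?_
    by_cases h0 : P (s.1, s.2.1, s.2.2, x) = 0
    · simp [h0]
    · rw [hf s x h0]
  have sX : ∀ F : X → ℝ, ∑ s : Q × U × V, (∑ x, P (s.1, s.2.1, s.2.2, x)) * F (f s)
      = ∑ x, p x * F x := by
    intro F
    simp only [← kX]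
    rw [Finset.sum_comm]
    refine Finset.sum_congr rfl fun x _ => ?_
    rw [← Finset.sum_mul, ← mX x]
    simp only [Fintype.sum_prod_type]
  have eY : entropy (jointLaw P W) (fun ω => ω.2.2.2.2.1) = outputEntropy (leftChannel W) p :=
    entropy_of_law fun t => by
      rw [← law_unit_pair, law_jointLaw_left P W fun _ => ()]
      simp only [if_true, mX]
  have eZ : entropy (jointLaw P W) (fun ω => ω.2.2.2.2.2) = outputEntropy (rightChannel W) p :=
    entropy_of_law fun t => by
      rw [← law_unit_pair, law_jointLaw_right P W fun _ => ()]
      simp only [if_true, mX]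
  have eyU := entropy_output (P := jointLaw P W) (a := fun ω => (ω.1, ω.2.1))
    (b := fun ω => ω.2.2.2.2.1) (r := fun s => 1 / c ^ 4 * w ((eQ s.1).1 - (eU s.2).1))
    (q := fun s => q ((eQ s.1).1 - (eU s.2).1)) hL (fun s => hq _) (by
      rintro ⟨q', u⟩ t
      rw [law_jointLaw_left P W fun s => (s.1, s.2.1)]
      simp only [iU, Finset.mul_sum, mul_assoc])
  have ezU := entropy_output (P := jointLaw P W) (a := fun ω => (ω.1, ω.2.1))
    (b := fun ω => ω.2.2.2.2.2) (r := fun s => 1 / c ^ 4 * w ((eQ s.1).1 - (eU s.2).1))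
    (q := fun s => q ((eQ s.1).1 - (eU s.2).1)) hZ (fun s => hq _) (by
      rintro ⟨q', u⟩ t
      rw [law_jointLaw_right P W fun s => (s.1, s.2.1)]
      simp only [iU, Finset.mul_sum, mul_assoc])
  have eyV := entropy_output (P := jointLaw P W) (a := fun ω => (ω.1, ω.2.2.1))
    (b := fun ω => ω.2.2.2.2.1) (r := fun s => 1 / c ^ 4 * v ((eQ s.1).2.1 - (eV s.2).1))
    (q := fun s => r ((eQ s.1).2.1 - (eV s.2).1)) hL (fun s => hr _) (by
      rintro ⟨q', v'⟩ t
      rw [law_jointLaw_left P W fun s => (s.1, s.2.2)]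
      simp only [iV, Finset.mul_sum, mul_assoc])
  have ezV := entropy_output (P := jointLaw P W) (a := fun ω => (ω.1, ω.2.2.1))
    (b := fun ω => ω.2.2.2.2.2) (r := fun s => 1 / c ^ 4 * v ((eQ s.1).2.1 - (eV s.2).1))
    (q := fun s => r ((eQ s.1).2.1 - (eV s.2).1)) hZ (fun s => hr _) (by
      rintro ⟨q', v'⟩ t
      rw [law_jointLaw_right P W fun s => (s.1, s.2.2)]
      simp only [iV, Finset.mul_sum, mul_assoc])
  -- Given $(Q,U,V)$ the input is `f`, so the output law is a row of the channel and the conditional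
  -- entropy is pure noise entropy.
  have eyX := entropy_pair_of_kernel (p := jointLaw P W) (a := fun ω => (ω.1, ω.2.1, ω.2.2.1))
    (b := fun ω => ω.2.2.2.2.1) (r := fun s => ∑ x, P (s.1, s.2.1, s.2.2, x))
    (κ := fun s => leftChannel W (f s)) (fun s => (hL _).2) (fun s t => by
      rw [law_jointLaw_left P W fun s => (s.1, s.2.1, s.2.2)]
      simp only [iX, kX s fun x => leftChannel W x t])
  have ezX := entropy_pair_of_kernel (p := jointLaw P W) (a := fun ω => (ω.1, ω.2.1, ω.2.2.1))
    (b := fun ω => ω.2.2.2.2.2) (r := fun s => ∑ x, P (s.1, s.2.1, s.2.2, x))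
    (κ := fun s => rightChannel W (f s)) (fun s => (hZ _).2) (fun s t => by
      rw [law_jointLaw_right P W fun s => (s.1, s.2.1, s.2.2)]
      simp only [iX, kX s fun x => rightChannel W x t])
  rw [sU] at eyU ezU
  rw [sV] at eyV ezV
  rw [sX fun x => shannon (leftChannel W x)] at eyX
  rw [sX fun x => shannon (rightChannel W x)] at ezX
  obtain ⟨h₁, h₂, h₃, h₄⟩ := rateExcess_le_iff.1 hR
  simp only [sub_zero] at h₁ h₂ h₃ h₄
  -- The two sum-rate constraints occur in opposite orders in `rateExcess` and in `negRegion`.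
  refine mem_negRegion_of_le eY eZ eyU ezU eyV ezV eyX ezX h₁ h₂ ?_ ?_
  · refine h₄.trans_eq ?_
    rw [noiseEntropy]; ring
  · refine h₃.trans_eq ?_
    rw [noiseEntropy]; ring

end OneTimePad

/-! ### Converse for codes and achievable rates -/

section Converse

variable {X Y Z : Type*} [Fintype X] [DecidableEq X] [Fintype Y] [DecidableEq Y]
  [Fintype Z] [DecidableEq Z] {N : ℕ} {W : Fin N → X → Y × Z → ℝ}

theorem Code.errorProb_eq_sum {M₀ M₁ M₂ n : ℕ} (c : Code X Y Z N M₀ M₁ M₂ n) (j : Fin N) :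
    c.errorProb W j = ∑ ω : (Fin M₀ × Fin M₁ × Fin M₂) × (Fin n → Y × Z),
      if c.dec₁ j (fun i => (ω.2 i).1) ≠ some (ω.1.1, ω.1.2.1) ∨
          c.dec₂ j (fun i => (ω.2 i).2) ≠ some (ω.1.1, ω.1.2.2)
        then blockLaw (W j) (fun m => c.enc m.1 m.2.1 m.2.2) ω else 0 := by
  rw [Code.errorProb, Fintype.sum_prod_type, Fintype.sum_prod_type, Finset.sum_div]
  refine Finset.sum_congr rfl fun w₀ _ => ?_
  rw [Fintype.sum_prod_type, Finset.sum_div]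
  refine Finset.sum_congr rfl fun w₁ _ => ?_
  rw [Finset.sum_div]
  refine Finset.sum_congr rfl fun w₂ _ => ?_
  rw [← (Equiv.arrowProdEquivProdArrow (Fin n) (fun _ => Y) fun _ => Z).symm.sum_comp,
    Fintype.sum_prod_type, Finset.sum_div]
  refine Finset.sum_congr rfl fun y _ => ?_
  rw [Finset.sum_div]
  refine Finset.sum_congr rfl fun z _ => ?_
  simp only [blockLaw, Fintype.card_prod, Fintype.card_fin, Nat.cast_mul, ite_div, zero_div,
    mul_assoc]
  rfl

theorem Code.errorProb_nonneg {M₀ M₁ M₂ n : ℕ} (hW : ∀ j x, W j x ∈ stdSimplex ℝ (Y × Z))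
    (c : Code X Y Z N M₀ M₁ M₂ n) (j : Fin N) : 0 ≤ c.errorProb W j := by
  rw [c.errorProb_eq_sum]
  refine Finset.sum_nonneg fun ω _ => ?_
  split_ifs
  · exact div_nonneg (Finset.prod_nonneg fun i _ => (hW j _).1 _) (Nat.cast_nonneg _)
  · exact le_rfl

theorem Code.exists_hullPairs {M₀ M₁ M₂ n : ℕ} (hW : ∀ j x, W j x ∈ stdSimplex ℝ (Y × Z))
    (hn : 0 < n) (h₀ : 0 < M₀) (h₁ : 0 < M₁) (h₂ : 0 < M₂)
    (c : Code X Y Z N M₀ M₁ M₂ n) (j : Fin N) :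
    ∃ k ∈ hullPairs (leftChannel (W j)) (rightChannel (W j)),
      rateExcess (leftChannel (W j)) (rightChannel (W j))
        (((1 - c.errorProb W j) * Real.logb 2 M₁ - 1) / n)
        (((1 - c.errorProb W j) * Real.logb 2 M₂ - 1) / n) k ≤ 0 := by
  have : NeZero M₀ := ⟨h₀.ne'⟩
  have : NeZero M₁ := ⟨h₁.ne'⟩
  have : NeZero M₂ := ⟨h₂.ne'⟩
  have r₀ : (M₀ : ℝ) ≠ 0 := by positivity
  have r₁ : (M₁ : ℝ) ≠ 0 := by positivity
  have r₂ : (M₂ : ℝ) ≠ 0 := by positivity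
  have hpos : ∀ ω, 0 ≤ blockLaw (W j)
      (fun m : Fin M₀ × Fin M₁ × Fin M₂ => c.enc m.1 m.2.1 m.2.2) ω :=
    (blockLaw_mem_stdSimplex (hW j) _).1
  have key := exists_hullPairs_of_block hn (hW j)
    (fun m : Fin M₀ × Fin M₁ × Fin M₂ => c.enc m.1 m.2.1 m.2.2) (fun m => m.2.1) (fun m => m.2.2)
    (fun s => by
      refine (law_message (hW j) _ (fun m : Fin M₀ × Fin M₁ × Fin M₂ => m.2.1) s).trans ?_
      simp only [Fintype.sum_prod_type]
      rw [Finset.sum_congr rfl fun _ _ => Finset.sum_comm]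
      simp
      field_simp)
    (fun s => by
      refine (law_message (hW j) _ (fun m : Fin M₀ × Fin M₁ × Fin M₂ => m.2.2) s).trans ?_
      simp only [Fintype.sum_prod_type]
      simp
      field_simp)
    (fun s => by
      refine (law_message (hW j) _ (fun m : Fin M₀ × Fin M₁ × Fin M₂ => (m.2.1, m.2.2)) s).trans ?_
      simp [Fintype.sum_prod_type, Prod.ext_iff, ite_and]
      field_simp)
    -- Only the private message is kept. Failing to decode it implies failing to decode the pair, so
    -- `errorProb` bounds both errors; the common message remains as randomness of the encoder.
    (fun y => (c.dec₁ j y).map Prod.snd) (fun z => (c.dec₂ j z).map Prod.snd)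
    (Pe := c.errorProb W j) ?_ ?_
  · simpa only [Fintype.card_fin] using key
  all_goals
    rw [c.errorProb_eq_sum]
    refine Finset.sum_le_sum fun ω _ => ?_
    split_ifs with ha hb hb
    · exact le_rfl
    · exfalso
      push Not at hb
      simp [hb] at ha
    · exact hpos ω
    · exact le_rfl

theorem eventually_sub_le_of_le_liminf {M : ℕ → ℕ} {Pe : ℕ → ℝ} {R ε : ℝ} (hε : 0 < ε)
    (hPe : Tendsto Pe atTop (𝓝 0))
    (hR : (R : EReal) ≤
      liminf (fun n : ℕ => ((1 / (n : ℝ) * Real.logb 2 (M n) : ℝ) : EReal)) atTop) :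
    ∀ᶠ n : ℕ in atTop, R - ε ≤ ((1 - Pe n) * Real.logb 2 (M n) - 1) / n := by
  have h1 : ((R - ε / 2 : ℝ) : EReal) <
      liminf (fun n : ℕ => ((1 / (n : ℝ) * Real.logb 2 (M n) : ℝ) : EReal)) atTop :=
    lt_of_lt_of_le (EReal.coe_lt_coe_iff.2 (by linarith)) hR
  have h2 : Tendsto (fun n : ℕ => (1 - Pe n) * (R - ε / 2) - 1 / (n : ℝ)) atTop
      (𝓝 ((1 - 0) * (R - ε / 2) - 0)) :=
    ((tendsto_const_nhds.sub hPe).mul_const _).sub tendsto_one_div_atTop_nhds_zero_nat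
  -- An error below 1 makes the factor `1 - Pe n` positive, so that the bound on the rate can be
  -- multiplied by it.
  filter_upwards [eventually_lt_of_lt_liminf h1, h2.eventually_const_lt (u := R - ε) (by linarith),
    hPe.eventually_lt_const one_pos] with n h3 h4 h5
  have h3 := EReal.coe_lt_coe_iff.1 h3
  have h6 := mul_le_mul_of_nonneg_left h3.le (sub_nonneg.2 h5.le)
  have h7 : ((1 - Pe n) * Real.logb 2 (M n) - 1) / n
      = (1 - Pe n) * (1 / (n : ℝ) * Real.logb 2 (M n)) - 1 / n := by ring
  linarith

/-- The converse: achievable rates satisfy the outer bound of each channel. -/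
theorem Achievable.exists_hullPairs (hW : ∀ j x, W j x ∈ stdSimplex ℝ (Y × Z)) {R₀ R₁ R₂ : ℝ}
    (h : Achievable W R₀ R₁ R₂) (j : Fin N) :
    ∃ k ∈ hullPairs (leftChannel (W j)) (rightChannel (W j)),
      rateExcess (leftChannel (W j)) (rightChannel (W j)) R₁ R₂ k ≤ 0 := by
  obtain ⟨M₀, M₁, M₂, c, hM, -, hR₁, hR₂, hPe⟩ := h
  have hPj : Tendsto (fun n => (c n).errorProb W j) atTop (𝓝 0) :=
    squeeze_zero (fun n => (c n).errorProb_nonneg hW j)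
      (fun n => le_ciSup (f := fun j => (c n).errorProb W j) (Set.finite_range _).bddAbove j) hPe
  refine exists_hullPairs_of_forall_pos fun ε hε => ?_
  -- Each rate may lose only `ε / 2`, because the sum rate must lose at most `ε`.
  obtain ⟨n, h1, h2, hn⟩ := ((eventually_sub_le_of_le_liminf (half_pos hε) hPj hR₁).and
    ((eventually_sub_le_of_le_liminf (half_pos hε) hPj hR₂).and (eventually_gt_atTop 0))).exists
  obtain ⟨k, hk, hle⟩ := (c n).exists_hullPairs hW hn (hM n).1 (hM n).2.1 (hM n).2.2 j
  refine ⟨k, hk, ?_⟩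
  rw [rateExcess_le_iff] at hle ⊢
  obtain ⟨l1, l2, l3, l4⟩ := hle
  refine ⟨?_, ?_, ?_, ?_⟩ <;> linarith

theorem Achievable.nonempty_input {R₀ R₁ R₂ : ℝ} (h : Achievable W R₀ R₁ R₂) : Nonempty X := by
  obtain ⟨M₀, M₁, M₂, c, hM, -⟩ := h
  -- Block length 1, since a codeword of length 0 has no letter.
  exact ⟨(c 1).enc ⟨0, (hM 1).1⟩ ⟨0, (hM 1).2.1⟩ ⟨0, (hM 1).2.2⟩ 0⟩

end Converse

theorem const_mem_stdSimplex {ι G : Type*} [Fintype ι] [Fintype G] [Nonempty G] (e : ι ≃ G × G) :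
    (fun _ => 1 / (Fintype.card G : ℝ) ^ 2) ∈ stdSimplex ℝ ι := by
  refine ⟨fun _ => by positivity, ?_⟩
  have : (Fintype.card G : ℝ) ≠ 0 := by exact_mod_cast Fintype.card_ne_zero
  rw [Finset.sum_const, Finset.card_univ, Fintype.card_congr e, Fintype.card_prod]
  simp
  field_simp

end CompoundBC

end

/-! ### The outer bound -/

theorem theorem1 {X Y Z : Type*} [Fintype X] [Fintype Y] [DecidableEq Y]
    [Fintype Z] [DecidableEq Z] (N : ℕ) (W : Fin N → X → Y × Z → ℝ)
    (hW : ∀ j x, W j x ∈ stdSimplex ℝ (Y × Z)) :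
    (fun R : ℝ × ℝ × ℝ => (R.2.1, R.2.2)) '' CompoundBC.capacityRegion W ⊆
      ⋃ (a : ℕ) (b : ℕ) (pU ∈ stdSimplex ℝ (Fin a)) (pV ∈ stdSimplex ℝ (Fin b)),
        ⋂ j : Fin N,
          ⋃ (d : ℕ) (pQX ∈ {κ : Fin a → Fin b → Fin d × X → ℝ |
              (∀ u v, κ u v ∈ stdSimplex ℝ (Fin d × X)) ∧ CompoundBC.InputDeterministic κ}),
            CompoundBC.negRegion (W j) (CompoundBC.inputLaw pU pV pQX) := by
  classical
  rintro _ ⟨⟨R₀, R₁, R₂⟩, hR, rfl⟩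
  have hR : CompoundBC.Achievable W R₀ R₁ R₂ := hR
  have : Nonempty X := hR.nonempty_input
  -- The key group, cyclic of the order supplied by Carathéodory's theorem, indexes the mixtures of
  -- every channel and also has room for an injective image of `X`. It is fixed before `j`, hence so
  -- are the uniform laws of `U` and `V` on `G × G`.
  let G := Fin (Fintype.card X + 3)
  let eK := (Fintype.equivFin (G × G)).symm
  let eQ := (Fintype.equivFin (G × G × G)).symm
  let e : X → G := fun x => Fin.castAdd 3 (Fintype.equivFin X x)
  have he : Function.Injective e :=
    (Fin.castAdd_injective _ 3).comp (Fintype.equivFin X).injective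
  simp only [Set.mem_iUnion, Set.mem_iInter]
  refine ⟨_, _, _, CompoundBC.const_mem_stdSimplex eK, _, CompoundBC.const_mem_stdSimplex eK,
    fun j => ?_⟩
  obtain ⟨⟨⟨p, α, β⟩, ⟨p', γ, δ⟩⟩, ⟨h₁, h₂, hp⟩, hk⟩ := hR.exists_hullPairs hW j
  obtain rfl : p = p' := hp
  have hps : p ∈ stdSimplex ℝ X := CompoundBC.mem_stdSimplex_of_mem_entropyHull h₁
  obtain ⟨w, hw, q, hq, hwq, rfl, rfl⟩ := CompoundBC.exists_fin_of_mem_entropyHull h₁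
  obtain ⟨v, hv, r, hr, hvr, rfl, rfl⟩ := CompoundBC.exists_fin_of_mem_entropyHull h₂
  refine ⟨_, CompoundBC.padKernel eQ eK eK e (CompoundBC.coupling w v q r p), ⟨?_, ?_⟩,
    CompoundBC.mem_negRegion_padKernel eQ eK eK e (hW j) he hw hv hq hr hwq hvr hk⟩
  · refine CompoundBC.padKernel_mem_stdSimplex eQ eK eK e _
      (CompoundBC.coupling_nonneg hw hv hq hr hps) ?_
    rw [← hps.2]
    refine Finset.sum_congr rfl fun x _ => ?_
    rw [← congrFun hwq x, Finset.sum_apply]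
    exact Finset.sum_congr rfl fun s _ => CompoundBC.sum_coupling_right hw hq hwq hvr s x
  · exact CompoundBC.inputDeterministic_padKernel eQ eK eK e _ he
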